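/- Consider $n$ independent malleable tasks on $C\ge 1$ identical machines. Task $i$ has a workload $D_i\in\mathbb Z_{>0}$, a parallelism bound $k_i\in\mathbb Z_{>0}$, a rational weight $w_i\ge 0$ and a due date $e_i\in\mathbb Z_{\ge 0}$. Time is divided into slots $1,2,3,\dots$. A feasible schedule assigns to each task $i$ and slot $t$ a number $y_i(t)\in\{0,1,\dots,k_i\}$ of machines such that $\sum_i y_i(t)\le C$ for every $t$ and every task $i$ has a finite completion time $t_i=\min\{t:\sum_{s=1}^{t}y_i(s)\ge D_i\}$. (a) There is a polynomial-time $(1+\epsilon)$-approximation algorithm for minimizing the maximum weighted completion time $\max_i w_i t_i$: given an instance and a rational $\epsilon>0$ as input, it outputs a feasible schedule with $\max_i w_i t_i\le(1+\epsilon)\,\mathrm{OPT}$, where $\mathrm{OPT}$ is the minimum of this objective over all feasible schedules. (b) There is likewise a polynomial-time approximation algorithm for minimizing the maximum weighted lateness $\max_i w_i(t_i-e_i)$: given an instance and a rational $\epsilon>0$, it outputs a feasible schedule whose maximum weighted lateness is at most $L+\epsilon|L|$ for the value $L$ of every feasible schedule (in particular at most $(1+\epsilon)\,\mathrm{OPT}$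 when $\mathrm{OPT}\ge 0$). Here the running time is the number of steps on a random access machine with addition, subtraction and halving at unit cost, and it is bounded by a polynomial in the binary length of the input (all numbers of the instance, and $\epsilon$). The schedule is output as a list of blocks, each allocating a constant number of machines to one task during an interval of slots; $y_i(t)$ is the sum over the blocks of task $i$ that contain $t$. -/

import Mathlib

noncomputable section

namespace Malleable

/-! ### Independent malleable tasks on identical machines -/

/-- `C` identical machines and `n` independent malleable tasks; task `i` has a workload, a
parallelism bound, a weight and a due date. -/
structure Instance where
  n : ℕ
  C : ℕ
  C_pos : 0 < C
  demand : Fin n → ℕ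
  demand_pos : ∀ i, 0 < demand i
  bound : Fin n → ℕ
  bound_pos : ∀ i, 0 < bound i
  weight : Fin n → ℚ≥0
  due : Fin n → ℕ

/-- `y i t` is the number of machines allocated to task `i` in time slot `t`. The time slots
are `1, 2, 3, …`; the value at `t = 0` is irrelevant. -/
abbrev Schedule (I : Instance) : Type := Fin I.n → ℕ → ℕ

/-- The workload of task `i` that is executed in the time slots `1, …, t`. -/
def done {I : Instance} (y : Schedule I) (i : Fin I.n) (t : ℕ) : ℕ :=
  ∑ s ∈ Finset.Icc 1 t, y i s

/-- The parallelism bounds and the number of machines are respected in every time slot, and every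
task is eventually completed. -/
structure Feasible (I : Instance) (y : Schedule I) : Prop where
  parallelism : ∀ i t, 1 ≤ t → y i t ≤ I.bound i
  capacity : ∀ t, 1 ≤ t → ∑ i, y i t ≤ I.C
  complete : ∀ i, ∃ t, I.demand i ≤ done y i t

/-- The first time slot by the end of which the whole workload of task `i` has been executed. -/
def completionTime {I : Instance} (y : Schedule I) (i : Fin I.n) : ℕ :=
  sInf {t | I.demand i ≤ done y i t}

/-- The maximum weighted completion time (a maximum over finitely many tasks, `0` if there are
no tasks). -/
def maxWeightedCompletion (I : Instance) (y : Schedule I) : ℝ :=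
  ⨆ i, (I.weight i : ℝ) * (completionTime y i : ℝ)

/-- The maximum weighted lateness (a maximum over finitely many tasks, `0` if there are
no tasks). -/
def maxWeightedLateness (I : Instance) (y : Schedule I) : ℝ :=
  ⨆ i, (I.weight i : ℝ) * ((completionTime y i : ℝ) - (I.due i : ℝ))

/-! ### Random access machine

Registers and memory cells hold natural numbers. The only arithmetic operations are addition,
truncated subtraction and halving, and each elementary instruction takes one step; as there is no
multiplication, polynomially many steps amount to polynomial time on a Turing machine. -/

/-- Structured programs; the arguments named `r`, `a`, `b` are numbers of registers. -/
inductive Prog where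
  /-- `reg[r] := c` -/
  | const (r c : ℕ)
  /-- `reg[r] := reg[a] + reg[b]` -/
  | add (r a b : ℕ)
  /-- `reg[r] := reg[a] - reg[b]`, or `0` if this is negative -/
  | sub (r a b : ℕ)
  /-- `reg[r] := ⌊reg[a] / 2⌋` -/
  | half (r a : ℕ)
  /-- `reg[r] := mem[reg[a]]` -/
  | load (r a : ℕ)
  /-- `mem[reg[a]] := reg[b]` -/
  | store (a b : ℕ)
  /-- do nothing -/
  | skip
  /-- first `P`, then `Q` -/
  | seq (P Q : Prog)
  /-- `if reg[a] ≠ 0 then P else Q` -/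
  | cond (a : ℕ) (P Q : Prog)
  /-- `while reg[a] ≠ 0 do P` -/
  | loop (a : ℕ) (P : Prog)

/-- The state of the machine. -/
structure State where
  reg : ℕ → ℕ
  mem : ℕ → ℕ

/-- Write the value `v` to register `r`. -/
def State.setReg (s : State) (r v : ℕ) : State :=
  { s with reg := Function.update s.reg r v }

/-- Write the value `v` to memory cell `a`. -/
def State.setMem (s : State) (a v : ℕ) : State :=
  { s with mem := Function.update s.mem a v }

/-- `Exec P s t s'`: started in state `s`, the program `P` halts after exactly `t` steps, in state
`s'`. Every elementary instruction and every evaluation of a test takes one step. -/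
inductive Exec : Prog → State → ℕ → State → Prop where
  | const (r c : ℕ) (s : State) : Exec (.const r c) s 1 (s.setReg r c)
  | add (r a b : ℕ) (s : State) : Exec (.add r a b) s 1 (s.setReg r (s.reg a + s.reg b))
  | sub (r a b : ℕ) (s : State) : Exec (.sub r a b) s 1 (s.setReg r (s.reg a - s.reg b))
  | half (r a : ℕ) (s : State) : Exec (.half r a) s 1 (s.setReg r (s.reg a / 2))
  | load (r a : ℕ) (s : State) : Exec (.load r a) s 1 (s.setReg r (s.mem (s.reg a)))
  | store (a b : ℕ) (s : State) : Exec (.store a b) s 1 (s.setMem (s.reg a) (s.reg b))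
  | skip (s : State) : Exec .skip s 1 s
  | seq {P Q : Prog} {s s' s'' : State} {t t' : ℕ} :
      Exec P s t s' → Exec Q s' t' s'' → Exec (.seq P Q) s (t + t') s''
  | cond_true {a : ℕ} {P Q : Prog} {s s' : State} {t : ℕ} :
      s.reg a ≠ 0 → Exec P s t s' → Exec (.cond a P Q) s (t + 1) s'
  | cond_false {a : ℕ} {P Q : Prog} {s s' : State} {t : ℕ} :
      s.reg a = 0 → Exec Q s t s' → Exec (.cond a P Q) s (t + 1) s'
  | loop_step {a : ℕ} {P : Prog} {s s' s'' : State} {t t' : ℕ} :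
      s.reg a ≠ 0 → Exec P s t s' → Exec (.loop a P) s' t' s'' →
        Exec (.loop a P) s (t + t' + 1) s''
  | loop_done {a : ℕ} {P : Prog} {s : State} : s.reg a = 0 → Exec (.loop a P) s 1 s

/-! ### Input, output and approximation algorithms -/

/-- The input of an algorithm as a list of natural numbers: the number of tasks, the number of
machines, the accuracy `ε` as a reduced fraction, and then for each task its workload, its
parallelism bound, its weight as a reduced fraction and its due date. -/
def encode (I : Instance) (ε : ℚ≥0) : List ℕ :=
  [I.n, I.C, ε.num, ε.den] ++
    (List.finRange I.n).flatMap fun i =>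
      [I.demand i, I.bound i, (I.weight i).num, (I.weight i).den, I.due i]

/-- The size of a list of natural numbers: each number is written in binary and followed by a
separator. -/
def bitSize (l : List ℕ) : ℕ := (l.map fun x => Nat.size x + 1).sum

/-- The initial state: the input is stored in the memory cells `0, 1, 2, …`; all registers and
all other cells are `0`. -/
def initState (l : List ℕ) : State where
  reg := fun _ => 0
  mem := fun a => l.getD a 0

/-- The schedule that is described by a final state. Register `0` holds the number of blocks and
register `1` the address of the first block. A block consists of four consecutive cells
`i, f, l, c`, and allocates `c` machines to task `i` in each of the time slots `f, f + 1, …, l`. -/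
def output (I : Instance) (s : State) : Schedule I := fun i t =>
  ∑ j ∈ Finset.range (s.reg 0),
    if s.mem (s.reg 1 + 4 * j) = (i : ℕ) ∧
        s.mem (s.reg 1 + 4 * j + 1) ≤ t ∧ t ≤ s.mem (s.reg 1 + 4 * j + 2)
    then s.mem (s.reg 1 + 4 * j + 3) else 0

/-- `P` is a `(1 + ε)`-approximation algorithm for minimizing `cost`: given an instance and a
rational `ε > 0`, it halts after a number of steps that is polynomial in the size of this input,
with a feasible schedule whose cost `A` satisfies `A ≤ O + ε * |O|` for the optimal cost `O`, and
for the cost `O` of any other feasible schedule; for `0 ≤ O` this reads `A ≤ (1 + ε) * O`. -/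
def IsPolyTimeApprox (cost : (I : Instance) → Schedule I → ℝ) (P : Prog) : Prop :=
  ∃ p : Polynomial ℕ, ∀ (I : Instance) (ε : ℚ≥0), 0 < ε →
    ∃ (t : ℕ) (s : State), Exec P (initState (encode I ε)) t s ∧
      t ≤ p.eval (bitSize (encode I ε)) ∧
      Feasible I (output I s) ∧
      ∀ y : Schedule I, Feasible I y →
        cost I (output I s) ≤ cost I y + (ε : ℝ) * |cost I y|

end Malleable

end

namespace Malleable

/-! ### Structured programs -/

/-! The machine computes an exactly optimal schedule, so the bound holds for every `ε`. Completion
time is lateness with all due dates `0`; one argument, with a flag `late`, serves both objectives.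

Clearing denominators turns the weights into integers `W i`, and adding `∑ W e` turns the cost of
task `i` into `W i * t + c i` with `c i ≥ 0`. A value `lam` is then attainable iff every task can
meet its deadline `d i`, the last `t` with `W i * t + c i ≤ lam`, and `lam` is found by binary
search.

Deadlines can be met iff for every `s` the work that cannot wait, `∑ (D i - k i * (d i - s))` with
truncated terms, is at most `C * s` (`Hall`). Necessity is immediate, as task `i` executes at most
`k i * (d i - s)` units after `s`; `violation_of_schedule` treats the capped deadlines as well. By
convexity it suffices to test `s` at the deadlines (`hall_of_deadlines`), which leaves polynomially
many tests.

For sufficiency, cut time at the deadlines. In a segment of length `l`, serve the most urgent work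
first: find by binary search the last horizon whose urgent work fits into `C * l`, and fill the
remaining room with work from the next horizon. This preserves `Hall` for the remaining work
(`Hall.step`), so at its deadline a task has nothing left (`le_sum_machines`). Inside a segment the
shares are laid out consecutively in rows of length `l`. A share of at most `k i * l` units meets
each column at most `k i` times, and a total of at most `C * l` meets it at most `C` times
(`machines_le`, `sum_machines_le`). The column count of a task changes at two places only, so three
blocks per task and segment describe the schedule (`blocks_cover`).

For the running time, `Computes` is a calculus of quantities that programs evaluate in time
polynomial in register `2`, which holds `K`, that is `16` times the input size. It is closed under
arithmetic, bounded sums and products, and binary search. The shares depend recursively on earlier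
shares, so they are tabulated in memory (`exec_fill`, `fillMem_share`). `input_bounds` shows that
truncation to `K` bits loses nothing. -/

theorem exec_loop {P : Prog} {a N : ℕ} (Inv : ℕ → State → Prop)
    (hstep : ∀ j s, s.reg a = j + 1 → Inv (j + 1) s →
      ∃ t s', Exec P s t s' ∧ t ≤ N ∧ s'.reg a = j ∧ Inv j s') :
    ∀ j s, s.reg a = j → Inv j s →
      ∃ t s', Exec (.loop a P) s t s' ∧ t ≤ j * (N + 1) + 1 ∧ Inv 0 s' := by
  intro j
  induction j with
  | zero => exact fun s ha hI => ⟨1, s, .loop_done ha, by simp, hI⟩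
  | succ j ih =>
    intro s ha hI
    obtain ⟨t, s', he, ht, ha', hI'⟩ := hstep j s ha hI
    obtain ⟨t', s'', he', ht', hI''⟩ := ih s' ha' hI'
    refine ⟨_, s'', .loop_step (by omega) he he', ?_, hI''⟩
    rw [Nat.succ_mul]; omega

/-- Two states that agree on the registers below `d` and on the memory. -/
def Agree (d : ℕ) (s s' : State) : Prop := (∀ r < d, s'.reg r = s.reg r) ∧ s'.mem = s.mem

theorem Agree.trans {d : ℕ} {s s' s'' : State} (h : Agree d s s') (h' : Agree d s' s'') :
    Agree d s s'' := ⟨fun r hr => (h'.1 r hr).trans (h.1 r hr), h'.2.trans h.2⟩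

theorem Agree.mono {d e : ℕ} {s s' : State} (h : Agree e s s') (hd : d ≤ e) : Agree d s s' :=
  ⟨fun r hr => h.1 r (by omega), h.2⟩

theorem agree_setReg {d r : ℕ} (s : State) (v : ℕ) (h : d ≤ r) : Agree d s (s.setReg r v) :=
  ⟨fun i hi => by simp [State.setReg, Function.update_of_ne (show i ≠ r by omega)], rfl⟩

@[simp] theorem setReg_reg_self (s : State) (r v : ℕ) : (s.setReg r v).reg r = v := by
  simp [State.setReg]

theorem setReg_reg_ne (s : State) {r i : ℕ} (v : ℕ) (h : i ≠ r) :
    (s.setReg r v).reg i = s.reg i := by simp [State.setReg, h]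

@[simp] theorem setReg_mem (s : State) (r v : ℕ) : (s.setReg r v).mem = s.mem := rfl

/-- Within `N` steps, `P` writes `v` to register `e` and preserves the memory and all lower
registers. -/
def Evals (P : Prog) (s : State) (e v N : ℕ) : Prop :=
  ∃ t s', Exec P s t s' ∧ t ≤ N ∧ s'.reg e = v ∧ Agree e s s'

/-- The quantity `f` depends only on the memory and on the registers below `d`, and it can be
computed, without changing any of these, in time polynomial in the content of register `2`. -/
structure Computes (d : ℕ) (f : State → ℕ) : Prop where
  three_le : 3 ≤ d
  congr : ∀ s s', Agree d s s' → f s' = f s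
  exec : ∀ e, d ≤ e → ∃ (P : Prog) (p : Polynomial ℕ), ∀ s, Evals P s e (f s) (p.eval (s.reg 2))

namespace Computes

variable {d : ℕ} {f g h : State → ℕ}

theorem mono (hf : Computes d f) {e : ℕ} (hd : d ≤ e) : Computes e f :=
  ⟨hf.three_le.trans hd, fun s s' h => hf.congr s s' (h.mono hd),
    fun e' he => hf.exec e' (hd.trans he)⟩

theorem of_eq (hf : Computes d f) (hfg : ∀ s, g s = f s) : Computes d g := by
  rwa [show g = f from funext hfg]

theorem const (hd : 3 ≤ d) (c : ℕ) : Computes d fun _ => c :=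
  ⟨hd, fun _ _ _ => rfl, fun e _ => ⟨.const e c, 1, fun s =>
    ⟨1, _, .const e c s, by simp, by simp, agree_setReg s c le_rfl⟩⟩⟩

theorem reg (hd : 3 ≤ d) {r : ℕ} (hr : r < d) : Computes d fun s => s.reg r :=
  ⟨hd, fun _ _ h => h.1 r hr, fun e he =>
    -- A register is copied by adding a zero to it.
    ⟨.seq (.const (e + 1) 0) (.add e r (e + 1)), Polynomial.C 2, fun s =>
      ⟨2, _, .seq (.const _ _ s) (.add e r (e + 1) _), by simp, by
        simp [setReg_reg_ne s 0 (show r ≠ e + 1 by omega)],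
        (agree_setReg s 0 (by omega)).trans (agree_setReg _ _ le_rfl)⟩⟩⟩

theorem unop (op : ℕ → Prog) (F : (ℕ → ℕ) → ℕ → ℕ)
    (hop : ∀ e s, Exec (op e) s 1 (s.setReg e (F s.mem (s.reg e))))
    (hf : Computes d f) : Computes d fun s => F s.mem (f s) := by
  refine ⟨hf.three_le, fun s s' h => by rw [hf.congr s s' h, h.2], fun e he => ?_⟩
  obtain ⟨P, p, hP⟩ := hf.exec e he
  refine ⟨.seq P (op e), p + 1, fun s => ?_⟩
  obtain ⟨t, s', h1, h2, h3, h4⟩ := hP s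
  refine ⟨_, _, .seq h1 (hop e s'), by simpa using h2, ?_, h4.trans (agree_setReg _ _ le_rfl)⟩
  simp [h3, h4.2]

/-- Registers act as a stack: the second operand is evaluated at level `e + 1`, which protects the
first one in register `e`. -/
theorem binop (op : ℕ → ℕ → ℕ → Prog) (F : ℕ → ℕ → ℕ)
    (hop : ∀ r a b s, Exec (op r a b) s 1 (s.setReg r (F (s.reg a) (s.reg b))))
    (hf : Computes d f) (hg : Computes d g) : Computes d fun s => F (f s) (g s) := by
  refine ⟨hf.three_le, fun s s' h => by rw [hf.congr s s' h, hg.congr s s' h], fun e he => ?_⟩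
  obtain ⟨P, p, hP⟩ := hf.exec e he
  obtain ⟨Q, q, hQ⟩ := hg.exec (e + 1) (by omega)
  refine ⟨.seq P (.seq Q (op e e (e + 1))), p + (q + 1), fun s => ?_⟩
  obtain ⟨t, s', h1, h2, h3, h4⟩ := hP s
  obtain ⟨t', s'', h1', h2', h3', h4'⟩ := hQ s'
  have hd := hf.three_le
  rw [h4.1 2 (by omega)] at h2'
  refine ⟨_, _, .seq h1 (.seq h1' (hop e e (e + 1) s'')), by simp; omega, ?_,
    h4.trans ((h4'.mono (by omega)).trans (agree_setReg _ _ le_rfl))⟩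
  rw [setReg_reg_self, h3', h4'.1 e (by omega), h3, hg.congr s s' (h4.mono he)]

theorem half (hf : Computes d f) : Computes d fun s => f s / 2 :=
  hf.unop (fun e => .half e e) (fun _ v => v / 2) fun e s => .half e e s

theorem load (hf : Computes d f) : Computes d fun s => s.mem (f s) :=
  hf.unop (fun e => .load e e) (fun m v => m v) fun e s => .load e e s

theorem add (hf : Computes d f) (hg : Computes d g) : Computes d fun s => f s + g s :=
  hf.binop .add (· + ·) (fun r a b s => .add r a b s) hg

theorem sub (hf : Computes d f) (hg : Computes d g) : Computes d fun s => f s - g s :=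
  hf.binop .sub (· - ·) (fun r a b s => .sub r a b s) hg

theorem ite (hf : Computes d f) (hg : Computes d g) (hh : Computes d h) :
    Computes d fun s => if f s ≠ 0 then g s else h s := by
  refine ⟨hf.three_le, fun s s' H => by
    rw [hf.congr s s' H, hg.congr s s' H, hh.congr s s' H], fun e he => ?_⟩
  obtain ⟨P, p, hP⟩ := hf.exec e he
  obtain ⟨Q, q, hQ⟩ := hg.exec e he
  obtain ⟨R, r, hR⟩ := hh.exec e he
  refine ⟨.seq P (.cond e Q R), p + (q + r + 1), fun s => ?_⟩
  obtain ⟨t, s', h1, h2, h3, h4⟩ := hP s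
  have hd := hf.three_le
  have hK : s'.reg 2 = s.reg 2 := h4.1 2 (by omega)
  by_cases h0 : f s ≠ 0
  · obtain ⟨t', s'', h1', h2', h3', h4'⟩ := hQ s'
    rw [hK] at h2'
    refine ⟨_, _, .seq h1 (.cond_true (h3 ▸ h0) h1'), by simp; omega, ?_, h4.trans h4'⟩
    rw [if_pos h0, h3', hg.congr s s' (h4.mono he)]
  · obtain ⟨t', s'', h1', h2', h3', h4'⟩ := hR s'
    rw [hK] at h2'
    refine ⟨_, _, .seq h1 (.cond_false (by rw [h3]; simpa using h0) h1'), by simp; omega, ?_,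
      h4.trans h4'⟩
    rw [if_neg h0, h3', hh.congr s s' (h4.mono he)]

/-- `φ s` can be evaluated at computable arguments. -/
def Closed (d : ℕ) (φ : State → ℕ → ℕ) : Prop :=
  ∀ e, d ≤ e → ∀ u, Computes e u → Computes e fun s => φ s (u s)

/-- `φ s` can be evaluated at two computable arguments. -/
def Closed₂ (d : ℕ) (φ : State → ℕ → ℕ → ℕ) : Prop :=
  ∀ e, d ≤ e → ∀ u v, Computes e u → Computes e v → Computes e fun s => φ s (u s) (v s)

/-- A loop whose number of iterations is polynomially bounded. -/
theorem iter {c : State → ℕ} {φ : State → ℕ → ℕ → ℕ} (hc : Computes d c) (q : Polynomial ℕ)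
    (hq : ∀ s, c s ≤ q.eval (s.reg 2)) (hf : Computes d f) (hφ : Closed₂ d φ) :
    Computes d fun s => Nat.rec (f s) (fun t a => φ s t a) (c s) := by
  have hd := hc.three_le
  have hcon : ∀ s s', Agree d s s' → φ s' = φ s := fun s s' H => by
    funext t a
    exact (hφ d le_rfl _ _ (const hd t) (const hd a)).congr s s' H
  refine ⟨hd, fun s s' H => by rw [hc.congr s s' H, hf.congr s s' H, hcon s s' H], fun e he => ?_⟩
  obtain ⟨P, p, hP⟩ := hf.exec e he
  obtain ⟨Q, q', hQ⟩ := hc.exec (e + 2) (by omega)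
  obtain ⟨R, r, hR⟩ := (hφ (e + 3) (by omega) _ _ (reg (by omega) (show e + 1 < e + 3 by omega))
    (reg (by omega) (show e < e + 3 by omega))).exec (e + 3) le_rfl
  -- Register `e` holds the accumulator, `e + 1` the index counting up, `e + 2` the remaining
  -- iterations; the body works from `e + 3` on.
  refine ⟨.seq P (.seq (.const (e + 1) 0) (.seq Q (.loop (e + 2) (.seq R (.seq (.const (e + 4) 0)
    (.seq (.add e (e + 3) (e + 4)) (.seq (.const (e + 3) 1) (.seq (.add (e + 1) (e + 1) (e + 3))
      (.sub (e + 2) (e + 2) (e + 3)))))))))),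
    -- `6` accounts for five bookkeeping instructions and the loop test.
    p + 1 + q' + (q * (r + Polynomial.C 6) + 1), fun s => ?_⟩
  obtain ⟨t₁, s₁, h1, h2, h3, h4⟩ := hP s
  have a2 := h4.trans (agree_setReg s₁ 0 (show e ≤ e + 1 by omega))
  obtain ⟨t₃, s₃, k1, k2, k3, k4⟩ := hQ (s₁.setReg (e + 1) 0)
  have a3 := a2.trans (k4.mono (by omega))
  have hc3 : s₃.reg (e + 2) = c s := by rw [k3, hc.congr _ _ (a2.mono he)]
  obtain ⟨t₄, s₄, l1, l2, l3⟩ := exec_loop (P := (.seq R (.seq (.const (e + 4) 0)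
    (.seq (.add e (e + 3) (e + 4)) (.seq (.const (e + 3) 1) (.seq (.add (e + 1) (e + 1) (e + 3))
      (.sub (e + 2) (e + 2) (e + 3)))))))) (a := e + 2) (N := r.eval (s.reg 2) + 5)
      (fun j s' => j ≤ c s ∧ Agree e s s' ∧ s'.reg (e + 1) = c s - j ∧
        s'.reg e = Nat.rec (f s) (fun t a => φ s t a) (c s - j)) (by
    rintro j s' hj ⟨hjc, hag, ht, ha⟩
    obtain ⟨t, s'', m1, m2, m3, m4⟩ := hR s'
    have n0 : s''.reg e = s'.reg e := m4.1 _ (by omega)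
    have n1 : s''.reg (e + 1) = s'.reg (e + 1) := m4.1 _ (by omega)
    have n2 : s''.reg (e + 2) = s'.reg (e + 2) := m4.1 _ (by omega)
    rw [hag.1 2 (by omega)] at m2
    refine ⟨_, _, .seq m1 (.seq (.const _ _ _) (.seq (.add _ _ _ _) (.seq (.const _ _ _)
      (.seq (.add _ _ _ _) (.sub _ _ _ _))))), by omega, ?_, by omega, ?_, ?_, ?_⟩
    · simp [State.setReg, n2, hj]
    · refine hag.trans ⟨fun i hi => ?_, m4.2⟩
      have := m4.1 i (by omega)
      simp [State.setReg, Function.update_apply, this]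
      split_ifs <;> omega
    · simp [State.setReg, n1, ht]; omega
    · have : c s - j = (c s - (j + 1)) + 1 := by omega
      rw [this]
      simp [State.setReg, m3, ht, ha, hcon s s' (hag.mono he)]) (c s) s₃ hc3
      ⟨le_rfl, a3, by simpa using k4.1 (e + 1) (by omega), by
        rw [Nat.sub_self, k4.1 e (by omega), setReg_reg_ne _ _ (by omega), h3]; rfl⟩
  refine ⟨_, s₄, .seq h1 (.seq (.const _ _ _) (.seq k1 l1)), ?_, by simpa using l3.2.2.2,
    l3.2.1⟩
  rw [a2.1 2 (by omega)] at k2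
  have := Nat.mul_le_mul_right (r.eval (s.reg 2) + 6) (hq s)
  have l2' : t₄ ≤ c s * (r.eval (s.reg 2) + 6) + 1 := l2
  simp; omega

end Computes

/-- The memory after the cells `A, A + 1, …, A + Q - 1` have been filled one after the other. -/
def fillMem (E : (ℕ → ℕ) → ℕ → ℕ) (A : ℕ) (m : ℕ → ℕ) (Q : ℕ) : ℕ → ℕ :=
  Nat.rec m (fun q m' => Function.update m' (A + q) (E m' q)) Q

/-- `E` sees the current memory, so an entry may use the entries already written. This gives
recursion with a table, which `Computes` alone, never writing to memory, does not offer. -/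
theorem exec_fill {d : ℕ} {A c : State → ℕ} {E : ℕ → (ℕ → ℕ) → ℕ → ℕ} (hA : Computes d A)
    (hc : Computes d c) (q : Polynomial ℕ) (hq : ∀ s, c s ≤ q.eval (s.reg 2))
    (hE : Computes.Closed d fun s => E (s.reg 2) s.mem) :
    ∃ (P : Prog) (p : Polynomial ℕ), ∀ s, ∃ t s', Exec P s t s' ∧ t ≤ p.eval (s.reg 2) ∧
      (∀ r < d, s'.reg r = s.reg r) ∧ s'.mem = fillMem (E (s.reg 2)) (A s) s.mem (c s) := by
  have hd := hc.three_le
  obtain ⟨P, p, hP⟩ := hA.exec d le_rfl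
  obtain ⟨Q, q', hQ⟩ := hc.exec (d + 2) (by omega)
  obtain ⟨R, r, hR⟩ := (hE (d + 3) (by omega) _
    (Computes.reg (by omega) (show d + 1 < d + 3 by omega))).exec (d + 3) le_rfl
  refine ⟨.seq P (.seq (.const (d + 1) 0) (.seq Q (.loop (d + 2) (.seq R (.seq (.add (d + 4) d (d + 1))
    (.seq (.store (d + 4) (d + 3)) (.seq (.const (d + 3) 1) (.seq (.add (d + 1) (d + 1) (d + 3))
      (.sub (d + 2) (d + 2) (d + 3)))))))))),
    p + 1 + q' + (q * (r + Polynomial.C 6) + 1), fun s => ?_⟩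
  obtain ⟨t₁, s₁, h1, h2, h3, h4⟩ := hP s
  have a2 := h4.trans (agree_setReg s₁ 0 (show d ≤ d + 1 by omega))
  obtain ⟨t₃, s₃, k1, k2, k3, k4⟩ := hQ (s₁.setReg (d + 1) 0)
  have a3 := a2.trans (k4.mono (by omega))
  have hc3 : s₃.reg (d + 2) = c s := by rw [k3, hc.congr _ _ a2]
  obtain ⟨t₄, s₄, l1, l2, l3⟩ := exec_loop (P := (.seq R (.seq (.add (d + 4) d (d + 1))
    (.seq (.store (d + 4) (d + 3)) (.seq (.const (d + 3) 1) (.seq (.add (d + 1) (d + 1) (d + 3))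
      (.sub (d + 2) (d + 2) (d + 3)))))))) (a := d + 2) (N := r.eval (s.reg 2) + 5)
      (fun j s' => j ≤ c s ∧ (∀ r < d, s'.reg r = s.reg r) ∧ s'.reg (d + 1) = c s - j ∧
        s'.reg d = A s ∧ s'.mem = fillMem (E (s.reg 2)) (A s) s.mem (c s - j)) (by
    rintro j s' hj ⟨hjc, hag, ht, ha, hm⟩
    obtain ⟨t, s'', m1, m2, m3, m4⟩ := hR s'
    have n0 : s''.reg d = s'.reg d := m4.1 _ (by omega)
    have n1 : s''.reg (d + 1) = s'.reg (d + 1) := m4.1 _ (by omega)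
    have n2 : s''.reg (d + 2) = s'.reg (d + 2) := m4.1 _ (by omega)
    have n3 := m4.2
    dsimp only at m2 m3
    rw [hag 2 (by omega)] at m2 m3
    refine ⟨_, _, .seq m1 (.seq (.add _ _ _ _) (.seq (.store _ _ _) (.seq (.const _ _ _)
      (.seq (.add _ _ _ _) (.sub _ _ _ _))))), by omega, ?_, by omega, ?_, ?_, ?_, ?_⟩
    · simp [State.setReg, State.setMem, n2, hj]
    · intro i hi
      have := m4.1 i (by omega)
      simp [State.setReg, State.setMem, Function.update_apply, this]
      split_ifs <;> first | omega | exact hag i hi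
    · simp [State.setReg, State.setMem, n1, ht]; omega
    · simp [State.setReg, State.setMem, n0, ha]
    · have : c s - j = (c s - (j + 1)) + 1 := by omega
      rw [this]
      simp only [State.setReg, State.setMem, fillMem]
      simp [n0, n1, ha, ht, m3, n3, hm, fillMem]) (c s) s₃ hc3
      ⟨le_rfl, a3.1, by simpa using k4.1 (d + 1) (by omega), by
        rw [k4.1 d (by omega), setReg_reg_ne _ _ (by omega), h3], by
        simp [fillMem, a3.2]⟩
  refine ⟨_, s₄, .seq h1 (.seq (.const _ _ _) (.seq k1 l1)), ?_, l3.2.1, by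
    simpa using l3.2.2.2.2⟩
  rw [a2.1 2 (by omega)] at k2
  have := Nat.mul_le_mul_right (r.eval (s.reg 2) + 6) (hq s)
  have l2' : t₄ ≤ c s * (r.eval (s.reg 2) + 6) + 1 := l2
  simp; omega

theorem fillMem_of_lt {E : (ℕ → ℕ) → ℕ → ℕ} {A : ℕ} {m : ℕ → ℕ} {a : ℕ} (h : a < A) (Q : ℕ) :
    fillMem E A m Q a = m a := by
  induction Q with
  | zero => rfl
  | succ Q ih =>
    rw [← ih]
    exact Function.update_of_ne (by omega) _ _

theorem fillMem_stable {E : (ℕ → ℕ) → ℕ → ℕ} {A : ℕ} {m : ℕ → ℕ} {a Q Q' : ℕ} (h : a < A + Q)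
    (hQ : Q ≤ Q') : fillMem E A m Q' a = fillMem E A m Q a := by
  induction Q', hQ using Nat.le_induction with
  | base => rfl
  | succ Q' hQ ih =>
    rw [← ih]
    exact Function.update_of_ne (by omega) _ _

theorem fillMem_apply {E : (ℕ → ℕ) → ℕ → ℕ} {A : ℕ} {m : ℕ → ℕ} {q Q : ℕ} (h : q < Q) :
    fillMem E A m Q (A + q) = E (fillMem E A m q) q := by
  rw [fillMem_stable (Q := q + 1) (by omega) h]
  exact Function.update_self _ _ _

/-- Binary search for a number below `2 ^ b` at which the test `P` (nonzero means success) turns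
from success to failure. -/
def srch (b : ℕ) (P : ℕ → ℕ) : ℕ :=
  Nat.rec 0 (fun t x => if P (x + 2 ^ (b - 1 - t)) ≠ 0 then x + 2 ^ (b - 1 - t) else x) b

/-- No monotonicity of `P` is needed: the current interval always starts at `0` or at a success, and
ends at `2 ^ b` or at a failure. -/
theorem srch_spec (b : ℕ) (P : ℕ → ℕ) : srch b P < 2 ^ b ∧ (srch b P = 0 ∨ P (srch b P) ≠ 0) ∧
    (srch b P + 1 = 2 ^ b ∨ P (srch b P + 1) = 0) := by
  suffices H : ∀ t ≤ b, ∀ x : ℕ, x = Nat.rec 0 (fun t x =>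
      if P (x + 2 ^ (b - 1 - t)) ≠ 0 then x + 2 ^ (b - 1 - t) else x) t →
      x + 2 ^ (b - t) ≤ 2 ^ b ∧ (x = 0 ∨ P x ≠ 0) ∧
        (x + 2 ^ (b - t) = 2 ^ b ∨ P (x + 2 ^ (b - t)) = 0) by
    have := H b le_rfl _ rfl
    simp only [Nat.sub_self, pow_zero] at this
    exact this
  intro t
  induction t with
  | zero => rintro - x rfl; simp
  | succ t ih =>
    intro ht x hx
    obtain ⟨h1, h2, h3⟩ := ih (by omega) _ rfl
    dsimp only at hx
    generalize (Nat.rec 0 (fun t x =>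
      if P (x + 2 ^ (b - 1 - t)) ≠ 0 then x + 2 ^ (b - 1 - t) else x) t : ℕ) = y at *
    have e1 : 2 ^ (b - t) = 2 ^ (b - (t + 1)) + 2 ^ (b - (t + 1)) := by
      rw [show b - t = b - (t + 1) + 1 by omega, pow_succ]; ring
    have hpos : 0 < 2 ^ (b - (t + 1)) := by positivity
    rw [show b - 1 - t = b - (t + 1) by omega] at hx
    rw [e1] at h1 h3
    split_ifs at hx with hP
    · subst hx
      exact ⟨by omega, .inr hP, by rwa [add_assoc]⟩
    · subst hx
      exact ⟨by omega, h2, .inr (by simpa using hP)⟩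

theorem srch_lt (b : ℕ) (P : ℕ → ℕ) : srch b P < 2 ^ b := (srch_spec b P).1

/-- All probes lie below `2 ^ b`. Hence the test may be replaced by a version with truncated
arithmetic. -/
theorem srch_congr {b : ℕ} {P Q : ℕ → ℕ} (h : ∀ x < 2 ^ b, P x = Q x) : srch b P = srch b Q := by
  suffices H : ∀ t ≤ b, ∃ x, x + 2 ^ (b - t) ≤ 2 ^ b ∧
      x = Nat.rec 0 (fun t x =>
        if P (x + 2 ^ (b - 1 - t)) ≠ 0 then x + 2 ^ (b - 1 - t) else x) t ∧
      x = Nat.rec 0 (fun t x =>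
        if Q (x + 2 ^ (b - 1 - t)) ≠ 0 then x + 2 ^ (b - 1 - t) else x) t by
    obtain ⟨x, -, h1, h2⟩ := H b le_rfl
    exact h1.symm.trans h2
  intro t
  induction t with
  | zero => intro _; exact ⟨0, by simp, rfl, rfl⟩
  | succ t ih =>
    intro ht
    obtain ⟨x, h1, h2, h3⟩ := ih (by omega)
    have e1 : 2 ^ (b - t) = 2 ^ (b - (t + 1)) + 2 ^ (b - (t + 1)) := by
      rw [show b - t = b - (t + 1) + 1 by omega, pow_succ]; ring
    have e2 : b - 1 - t = b - (t + 1) := by omega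
    have hpos : 0 < 2 ^ (b - (t + 1)) := by positivity
    refine ⟨if P (x + 2 ^ (b - 1 - t)) ≠ 0 then x + 2 ^ (b - 1 - t) else x, ?_, ?_, ?_⟩
    · rw [e2]; split_ifs <;> omega
    · dsimp only; rw [← h2]
    · dsimp only; rw [← h3, h _ (by rw [e2]; omega)]

theorem le_srch {b : ℕ} {P : ℕ → ℕ} {x : ℕ} (hx : x < 2 ^ b) (hP : ∀ y ≤ x, P y ≠ 0) :
    x ≤ srch b P := by
  by_contra! hlt
  rcases (srch_spec b P).2.2 with h | h
  · omega
  · exact hP _ hlt h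

/-- A monotone search. -/
theorem srch_eq {b : ℕ} {P : ℕ → ℕ} {x : ℕ} (hx : x < 2 ^ b) (hP : ∀ y, P y ≠ 0 ↔ y ≤ x) :
    srch b P = x := by
  apply le_antisymm _ (le_srch hx fun y hy => (hP y).2 hy)
  rcases (srch_spec b P).2.1 with h | h
  · omega
  · exact (hP _).1 h

/-! ### Arithmetic, bounded sums and searches in polynomial time -/

namespace Computes

variable {d : ℕ} {f g h k : State → ℕ}

theorem bits (hd : 3 ≤ d) : Computes d fun s => s.reg 2 := reg hd (by omega)

theorem ite_lt (hf : Computes d f) (hg : Computes d g) (hh : Computes d h) (hk : Computes d k) :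
    Computes d fun s => if f s < g s then h s else k s :=
  ((hg.sub hf).ite hh hk).of_eq fun s => by split_ifs <;> first | rfl | omega

theorem ite_eq (hf : Computes d f) (hg : Computes d g) (hh : Computes d h) (hk : Computes d k) :
    Computes d fun s => if f s = g s then h s else k s :=
  (((hf.sub hg).add (hg.sub hf)).ite hk hh).of_eq fun s => by split_ifs <;> first | rfl | omega

theorem min (hf : Computes d f) (hg : Computes d g) : Computes d fun s => min (f s) (g s) :=
  (hf.sub (hf.sub hg)).of_eq fun s => by omega

/-- A loop that is cut off after `s.reg 2` iterations. -/
theorem iter_min {c : State → ℕ} {φ : State → ℕ → ℕ → ℕ} (hc : Computes d c)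
    (hf : Computes d f) (hφ : Closed₂ d φ) :
    Computes d fun s => Nat.rec (f s) (fun t a => φ s t a) (Min.min (c s) (s.reg 2)) :=
  iter (hc.min (bits hc.three_le)) Polynomial.X (fun s => by simp) hf hφ

theorem sum {c : State → ℕ} {φ : State → ℕ → ℕ} (hc : Computes d c) (hφ : Closed d φ) :
    Computes d fun s => ∑ j ∈ Finset.range (Min.min (c s) (s.reg 2)), φ s j := by
  refine (iter_min (φ := fun s t a => a + φ s t) hc (const hc.three_le 0)
    fun e he u v hu hv => hv.add (hφ e he u hu)).of_eq fun s => ?_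
  generalize Min.min (c s) (s.reg 2) = N
  induction N with
  | zero => rfl
  | succ N ih => rw [Finset.sum_range_succ, ih]

theorem shiftRight (hf : Computes d f) (hg : Computes d g) :
    Computes d fun s => f s / 2 ^ Min.min (g s) (s.reg 2) := by
  refine (iter_min (φ := fun s t a => a / 2) hg hf fun e he u v hu hv => hv.half).of_eq fun s => ?_
  generalize Min.min (g s) (s.reg 2) = N
  induction N with
  | zero => simp
  | succ N ih => rw [pow_succ, ← Nat.div_div_eq_div_mul, ih]

theorem shiftLeft (hf : Computes d f) (hg : Computes d g) :
    Computes d fun s => f s * 2 ^ Min.min (g s) (s.reg 2) := by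
  refine (iter_min (φ := fun s t a => a + a) hg hf fun e he u v hu hv => hv.add hv).of_eq
    fun s => ?_
  generalize Min.min (g s) (s.reg 2) = N
  induction N with
  | zero => simp
  | succ N ih => dsimp only; rw [← ih]; ring

/-- Shift and add over the lowest `K` bits of `g`. The truncation is needed because `Computes`
demands the time bound in every state, whatever the size of `g`. -/
theorem mul (hf : Computes d f) (hg : Computes d g) :
    Computes d fun s => f s * (g s % 2 ^ s.reg 2) := by
  have hd := hf.three_le
  -- With `v = g / 2 ^ j`, the difference `v - (v / 2 + v / 2)` is bit `j` of `g`.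
  have hφ : Closed d fun s j =>
      if g s / 2 ^ Min.min j (s.reg 2) - (g s / 2 ^ Min.min j (s.reg 2) / 2 +
        g s / 2 ^ Min.min j (s.reg 2) / 2) ≠ 0 then f s * 2 ^ Min.min j (s.reg 2) else 0 := by
    intro e he u hu
    have h1 := (hg.mono he).shiftRight hu
    exact (h1.sub (h1.half.add h1.half)).ite ((hf.mono he).shiftLeft hu)
      (const (hd.trans he) 0)
  refine (sum (bits hd) hφ).of_eq fun s => ?_
  rw [min_self]
  suffices H : ∀ N ≤ s.reg 2, f s * (g s % 2 ^ N) = ∑ j ∈ Finset.range N,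
      if g s / 2 ^ Min.min j (s.reg 2) - (g s / 2 ^ Min.min j (s.reg 2) / 2 +
        g s / 2 ^ Min.min j (s.reg 2) / 2) ≠ 0 then f s * 2 ^ Min.min j (s.reg 2) else 0 from
    H _ le_rfl
  intro N
  induction N with
  | zero => simp [Nat.mod_one]
  | succ N ih =>
    intro hN
    rw [Finset.sum_range_succ, ← ih (by omega), min_eq_left (by omega), Nat.mod_pow_succ]
    rcases Nat.mod_two_eq_zero_or_one (g s / 2 ^ N) with h | h
    · rw [h, if_neg (by omega)]; simp
    · rw [h, if_pos (by omega)]; ring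

theorem prod {c : State → ℕ} {φ : State → ℕ → ℕ} (hc : Computes d c) (hφ : Closed d φ) :
    Computes d fun s =>
      ∏ j ∈ Finset.range (Min.min (c s) (s.reg 2)), (φ s j % 2 ^ s.reg 2) := by
  refine (iter_min (φ := fun s t a => a * (φ s t % 2 ^ s.reg 2)) hc (const hc.three_le 1)
    fun e he u v hu hv => hv.mul (hφ e he u hu)).of_eq fun s => ?_
  generalize Min.min (c s) (s.reg 2) = N
  induction N with
  | zero => rfl
  | succ N ih => rw [Finset.prod_range_succ, ih]

theorem srch {φ : State → ℕ → ℕ} (hf : Computes d f) (hf' : ∀ s, f s ≤ s.reg 2)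
    (hφ : Closed d φ) : Computes d fun s => srch (f s) (φ s) := by
  have hd := hf.three_le
  refine (iter (φ := fun s t x => if φ s (x + 1 * 2 ^ Min.min (f s - 1 - t) (s.reg 2)) ≠ 0 then
    x + 1 * 2 ^ Min.min (f s - 1 - t) (s.reg 2) else x) hf Polynomial.X (by simpa using hf')
    (const hd 0) fun e he u v hu hv => ?_).of_eq fun s => ?_
  · have hd' := hd.trans he
    have h1 := hv.add ((const hd' 1).shiftLeft (((hf.mono he).sub (const hd' 1)).sub hu))
    exact (hφ e he _ h1).ite h1 hv
  · have h1 : ∀ t, Min.min (f s - 1 - t) (s.reg 2) = f s - 1 - t := fun t =>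
      min_eq_left (by have := hf' s; omega)
    simp only [h1, one_mul]
    rfl

theorem div (hf : Computes d f) (hg : Computes d g) :
    Computes d fun s => (f s % 2 ^ s.reg 2) / g s := by
  have hd := hf.three_le
  -- The quotient is the largest `x` with `g * x ≤ f`. For `g = 0` every test fails, which gives
  -- `0`, the value of division by zero.
  refine (srch (f := fun s => s.reg 2) (φ := fun s x =>
    if g s ≠ 0 then (1 * (f s % 2 ^ s.reg 2) + 1) - g s * (x % 2 ^ s.reg 2) else 0) (bits hd)
    (fun _ => le_rfl) fun e he u hu => ?_).of_eq fun s => ?_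
  · have hd' := hd.trans he
    exact (hg.mono he).ite ((((const hd' 1).mul (hf.mono he)).add (const hd' 1)).sub
      ((hg.mono he).mul hu)) (const hd' 0)
  · have hlt : f s % 2 ^ s.reg 2 < 2 ^ s.reg 2 := Nat.mod_lt _ (by positivity)
    have key : f s % 2 ^ s.reg 2 / g s < 2 ^ s.reg 2 := (Nat.div_le_self _ _).trans_lt hlt
    rw [srch_congr (Q := fun x => if g s ≠ 0 then ((f s % 2 ^ s.reg 2) + 1) - g s * x else 0)
      fun x hx => by rw [Nat.mod_eq_of_lt hx, one_mul]]
    rcases Nat.eq_zero_or_pos (g s) with h0 | h0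
    · rw [h0, Nat.div_zero]
      rcases (srch_spec (s.reg 2) fun x : ℕ => if (0 : ℕ) ≠ 0 then ((f s % 2 ^ s.reg 2) + 1) - 0 * x else
        0).2.1 with h | h
      · exact h.symm
      · simp at h
    · refine (srch_eq key fun y => ?_).symm
      rw [if_pos (by omega), Nat.le_div_iff_mul_le h0, mul_comm y]
      omega

end Computes

end Malleable

/-! ### Scheduling with deadlines -/

namespace Malleable

open Finset

/-! ### Boundary condition and greedy allocation -/

/-- By each time `s`, the work that has to be executed between `τ` and `s` fits. -/
def Hall (n C : ℕ) (k d R : ℕ → ℕ) (τ : ℕ) : Prop :=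
  ∀ s, τ ≤ s → ∑ i ∈ range n, (R i - k i * (d i - s)) ≤ C * (s - τ)

/-- The required work `g` is convex in `s` away from the deadlines. At a first violation `g` rises
by more than `C`. Up to the next deadline convexity keeps this slope, so the violation persists and
no deadline can be reached, since there the bound holds. Thus `g` would grow forever, although it is
at most `∑ D i`. -/
theorem hall_of_deadlines {n C : ℕ} {k d D : ℕ → ℕ} (h0 : ∀ j < n, D j ≤ k j * d j)
    (ht : ∀ j < n, ∑ i ∈ range n, (D i - k i * (d i - d j)) ≤ C * d j) : Hall n C k d D 0 := by
  set g : ℕ → ℕ := fun s => ∑ i ∈ range n, (D i - k i * (d i - s)) with hg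
  -- A term grows convexly up to `d i` and is constant afterwards; only the kink at `d i` is
  -- concave.
  have hconv : ∀ s, (∀ i < n, d i ≠ s + 1) → 2 * g (s + 1) ≤ g s + g (s + 2) := by
    intro s hs
    simp only [hg, mul_sum, ← sum_add_distrib]
    refine sum_le_sum fun i hi => ?_
    have := hs i (mem_range.1 hi)
    rcases lt_or_gt_of_ne this with h | h
    · simp [show d i - s = 0 by omega, show d i - (s + 1) = 0 by omega,
        show d i - (s + 2) = 0 by omega]; omega
    · obtain ⟨v, hv⟩ := Nat.exists_eq_add_of_le (show s + 2 ≤ d i by omega)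
      rw [show d i - s = v + 2 by omega, show d i - (s + 1) = v + 1 by omega,
        show d i - (s + 2) = v by omega]
      simp only [mul_add]
      omega
  intro s _
  by_contra! hlt
  have hex : ∃ s, C * s < g s := ⟨s, by simpa using hlt⟩
  have h1 := Nat.find_spec hex
  have h2 := fun m => Nat.find_min hex (m := m)
  generalize Nat.find hex = s0 at h1 h2
  have g0 : g 0 = 0 := by
    simp only [hg, Nat.sub_zero, sum_eq_zero_iff, mem_range]
    intro i hi; have := h0 i hi; omega
  obtain ⟨s1, rfl⟩ : ∃ s1, s0 = s1 + 1 := Nat.exists_eq_succ_of_ne_zero (by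
    rintro rfl; omega)
  have h3 := h2 s1 (by omega)
  have key : ∀ j, g (s1 + j) + C + 1 ≤ g (s1 + j + 1) ∧ C * (s1 + j + 1) < g (s1 + j + 1) ∧
      j ≤ g (s1 + j) := by
    intro j
    induction j with
    | zero => rw [mul_add] at h1; exact ⟨by simp; omega, by simpa [mul_add] using h1, by simp⟩
    | succ j ih =>
      obtain ⟨a, b, c⟩ := ih
      have := hconv (s1 + j) fun i hi h => by
        have := ht i hi
        rw [h] at this
        exact absurd b (not_lt.2 this)
      have e1 : s1 + (j + 1) = s1 + j + 1 := by ring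
      rw [e1]
      rw [show s1 + j + 2 = s1 + j + 1 + 1 by ring] at this
      have e2 : C * (s1 + j + 1 + 1) = C * (s1 + j + 1) + C := by ring
      omega
  have hub : ∀ s, g s ≤ ∑ i ∈ range n, D i := fun s => sum_le_sum fun i _ => Nat.sub_le _ _
  have := (key (∑ i ∈ range n, D i + 1)).2.2
  have := hub (s1 + (∑ i ∈ range n, D i + 1))
  omega

/-- What task `i` can execute in the next `l` slots of the work that is due by time `σ`. -/
def urgent (k d R : ℕ → ℕ) (l i σ : ℕ) : ℕ := min (R i - k i * (d i - σ)) (k i * l)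

theorem urgent_mono (k d R : ℕ → ℕ) (l i : ℕ) {σ σ' : ℕ} (h : σ ≤ σ') :
    urgent k d R l i σ ≤ urgent k d R l i σ' := by
  have := Nat.mul_le_mul_left (k i) (Nat.sub_le_sub_left h (d i))
  simp only [urgent]; omega

def urgentSum (n : ℕ) (k d R : ℕ → ℕ) (l σ : ℕ) : ℕ := ∑ i ∈ range n, urgent k d R l i σ

/-- The last time such that all urgent work fits into `l` slots. -/
def threshold (G n C : ℕ) (k d R : ℕ → ℕ) (l : ℕ) : ℕ :=
  srch G fun σ => C * l + 1 - urgentSum n k d R l σ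

/-- The amount of work that becomes urgent one slot after `σ`. -/
def urgentStep (k d R : ℕ → ℕ) (l σ i : ℕ) : ℕ :=
  urgent k d R l i (σ + 1) - urgent k d R l i σ

/-- The room left after horizon `σ` is given to the work of horizon `σ + 1`, in the order of the
tasks. -/
def allotAt (n C : ℕ) (k d R : ℕ → ℕ) (l i σ : ℕ) : ℕ :=
  urgent k d R l i σ + min (urgentStep k d R l σ i)
    (C * l - urgentSum n k d R l σ - ∑ j ∈ range i, urgentStep k d R l σ j)

/-- The work of task `i` in the next `l` slots: the most urgent work first. -/
def allot (G n C : ℕ) (k d R : ℕ → ℕ) (l i : ℕ) : ℕ :=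
  allotAt n C k d R l i (threshold G n C k d R l)

theorem sum_greedy (Δ : ℕ → ℕ) (room N : ℕ) :
    ∑ i ∈ range N, min (Δ i) (room - ∑ j ∈ range i, Δ j) = min room (∑ i ∈ range N, Δ i) := by
  induction N with
  | zero => simp
  | succ N ih => rw [sum_range_succ, ih, sum_range_succ]; omega

section Step

variable {G n C : ℕ} {k d R : ℕ → ℕ} {τ l : ℕ}

/-- The search may return `0` without a successful test. In that case `Hall` at `s = τ` says that no
work is overdue, so the urgent work at horizon `0` is `0`. -/
theorem urgentSum_threshold_le (hH : Hall n C k d R τ) :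
    urgentSum n k d R l (threshold G n C k d R l) ≤ C * l := by
  rcases (srch_spec G fun σ => C * l + 1 - urgentSum n k d R l σ).2.1 with h | h
  · rw [threshold, h]
    have h1 := hH τ le_rfl
    have h2 : urgentSum n k d R l 0 ≤ ∑ i ∈ range n, (R i - k i * (d i - τ)) :=
      sum_le_sum fun i _ => (urgent_mono k d R l i (Nat.zero_le τ)).trans (min_le_left _ _)
    simp only [Nat.sub_self, mul_zero] at h1
    omega
  · unfold threshold; omega

theorem le_allotAt (σ i : ℕ) : urgent k d R l i σ ≤ allotAt n C k d R l i σ :=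
  Nat.le_add_right _ _

theorem allotAt_le (σ i : ℕ) : allotAt n C k d R l i σ ≤ urgent k d R l i (σ + 1) := by
  have := urgent_mono k d R l i (Nat.le_succ σ)
  simp only [allotAt, urgentStep, Nat.succ_eq_add_one] at *
  omega

theorem allot_le_bound (i : ℕ) : allot G n C k d R l i ≤ k i * l := by
  have := allotAt_le (n := n) (C := C) (k := k) (d := d) (R := R) (l := l)
    (threshold G n C k d R l) i
  simp only [allot, urgent] at *; omega

theorem sum_allot (hH : Hall n C k d R τ) : ∑ i ∈ range n, allot G n C k d R l i =
    min (C * l) (urgentSum n k d R l (threshold G n C k d R l + 1)) := by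
  have h1 := urgentSum_threshold_le (G := G) (l := l) hH
  simp only [allot, allotAt]
  generalize threshold G n C k d R l = σ at *
  rw [sum_add_distrib, sum_greedy]
  have h2 : urgentSum n k d R l σ + ∑ i ∈ range n, urgentStep k d R l σ i =
      urgentSum n k d R l (σ + 1) := by
    simp only [urgentSum, ← sum_add_distrib]
    refine sum_congr rfl fun i _ => ?_
    have := urgent_mono k d R l i (Nat.le_succ σ)
    simp only [urgentStep, Nat.succ_eq_add_one] at *
    omega
  simp only [urgentSum] at *
  omega

/-- Either everything urgent for `s` has been served, and the condition at `s - l` carries over; or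
the capacity `C * l` is used up entirely by work that is urgent for `s`, and both sides of the
condition at `s` drop by `C * l`. -/
theorem Hall.step (hH : Hall n C k d R τ) (hG : ∀ i < n, d i < 2 ^ G) :
    Hall n C k d (fun i => R i - allot G n C k d R l i) (τ + l) := by
  intro s hs
  dsimp only
  have hsum := sum_allot (G := G) (l := l) hH
  -- all work that is due by `s` and can be executed is executed
  have all : (∀ i < n, urgent k d R l i s ≤ allot G n C k d R l i) →
      ∑ i ∈ range n, (R i - allot G n C k d R l i - k i * (d i - s)) ≤ C * (s - (τ + l)) := by
    intro h
    have h1 := hH (s - l) (by omega)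
    rw [show s - (τ + l) = s - l - τ by omega]
    refine le_trans (sum_le_sum fun i hi => ?_) h1
    have h2 := h i (mem_range.1 hi)
    have h3 : k i * (d i - (s - l)) ≤ k i * (d i - s) + k i * l := by
      rw [← mul_add]; exact Nat.mul_le_mul_left _ (by omega)
    simp only [urgent] at h2
    omega
  by_cases hs1 : s ≤ threshold G n C k d R l
  · exact all fun i _ => (urgent_mono k d R l i hs1).trans (le_allotAt _ _)
  by_cases hful : C * l ≤ urgentSum n k d R l (threshold G n C k d R l + 1)
  · rw [min_eq_left hful] at hsum
    have h1 := hH s (by omega)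
    have h2 : ∑ i ∈ range n, (R i - allot G n C k d R l i - k i * (d i - s)) +
        ∑ i ∈ range n, allot G n C k d R l i ≤ ∑ i ∈ range n, (R i - k i * (d i - s)) := by
      rw [← sum_add_distrib]
      refine sum_le_sum fun i _ => ?_
      have h3 : allot G n C k d R l i ≤ urgent k d R l i s :=
        (allotAt_le _ i).trans (urgent_mono k d R l i (by omega))
      simp only [urgent] at h3
      omega
    have h4 : C * (s - τ) = C * (s - (τ + l)) + C * l := by rw [← mul_add]; congr 1; omega
    omega
  -- Unused capacity means that the test succeeds even at the next horizon. The search thus ended at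
  -- `2 ^ G - 1`, beyond all deadlines.
  · have h5 : ∀ i < n, d i ≤ threshold G n C k d R l := by
      intro i hi
      rcases (srch_spec G fun σ => C * l + 1 - urgentSum n k d R l σ).2.2 with h | h
      · have := hG i hi; unfold threshold; omega
      · exact absurd (show C * l ≤ _ by unfold threshold; omega) hful
    refine all fun i hi => le_trans (le_of_eq ?_) (le_allotAt _ _)
    have := h5 i hi
    simp [urgent, show d i - s = 0 by omega, show d i - threshold G n C k d R l = 0 by omega]

end Step

/-! ### Segments between deadlines -/

/-- The first deadline after `τ`. -/
def next (G n : ℕ) (d : ℕ → ℕ) (τ : ℕ) : ℕ :=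
  srch G fun x => 1 - ∑ i ∈ range n, if τ < d i then if d i < x then 1 else 0 else 0

def segStart (G n : ℕ) (d : ℕ → ℕ) (p : ℕ) : ℕ := Nat.rec 0 (fun _ τ => next G n d τ) p

section Segments

variable {G n : ℕ} {d : ℕ → ℕ} {τ : ℕ}

theorem next_test (x : ℕ) : (1 - ∑ i ∈ range n, if τ < d i then if d i < x then 1 else 0 else 0) ≠ 0 ↔
    ∀ i < n, τ < d i → x ≤ d i := by
  rw [show ∀ a : ℕ, 1 - a ≠ 0 ↔ a = 0 by omega, sum_eq_zero_iff]
  simp only [mem_range]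
  refine forall₂_congr fun i _ => ?_
  by_cases h1 : τ < d i <;> by_cases h2 : d i < x <;> (simp [h1, h2]; try omega)

theorem next_le (i : ℕ) (hi : i < n) (h : τ < d i) : next G n d τ ≤ d i := by
  rcases (srch_spec G fun x =>
    1 - ∑ i ∈ range n, if τ < d i then if d i < x then 1 else 0 else 0).2.1 with h1 | h1
  · rw [next, h1]; omega
  · exact (next_test _).1 h1 i hi h

theorem next_eq (hG : ∀ i < n, d i < 2 ^ G) (h : ∃ i < n, τ < d i) :
    ∃ i < n, τ < d i ∧ next G n d τ = d i := by
  rcases (srch_spec G fun x =>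
    1 - ∑ i ∈ range n, if τ < d i then if d i < x then 1 else 0 else 0).2.2 with h1 | h1
  · obtain ⟨i, hi, h⟩ := h
    have := next_le (G := G) i hi h
    have := hG i hi
    exact ⟨i, hi, h, by unfold next at *; omega⟩
  · have h2 := (not_iff_not.2 (next_test (n := n) (d := d) (τ := τ) (next G n d τ + 1))).1
      (by simpa [next] using h1)
    push Not at h2
    obtain ⟨i, hi, h3, h4⟩ := h2
    have := next_le (G := G) i hi h3
    exact ⟨i, hi, h3, by omega⟩

theorem le_next (hG : ∀ i < n, d i < 2 ^ G) (hτ : τ < 2 ^ G) : τ ≤ next G n d τ := by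
  by_cases h : ∃ i < n, τ < d i
  · obtain ⟨i, _, h1, h2⟩ := next_eq hG h
    omega
  · push Not at h
    exact le_srch hτ fun y hy => (next_test y).2 fun i hi h1 => by have := h i hi; omega

theorem segStart_lt (p : ℕ) : segStart G n d p < 2 ^ G := by
  cases p with
  | zero => exact Nat.two_pow_pos G
  | succ p =>
    change next G n d (segStart G n d p) < _
    unfold next
    exact srch_lt _ _

theorem segStart_mono (hG : ∀ i < n, d i < 2 ^ G) : Monotone (segStart G n d) :=
  monotone_nat_of_le_succ fun p => le_next hG (segStart_lt p)

/-- Each step passes at least one of the remaining deadlines, so `n` segments suffice. -/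
theorem le_segStart (hG : ∀ i < n, d i < 2 ^ G) (i : ℕ) (hi : i < n) : d i ≤ segStart G n d n := by
  have key : ∀ p, (∀ i < n, d i ≤ segStart G n d p) ∨
      #{i ∈ range n | segStart G n d p < d i} + p ≤ n := by
    intro p
    induction p with
    | zero => exact .inr (by
      rw [add_zero]; exact (card_filter_le _ _).trans (card_range n).le)
    | succ p ih =>
      by_cases h : ∃ i < n, segStart G n d p < d i
      · right
        rcases ih with ih | ih
        · obtain ⟨i, hi, h⟩ := h
          have := ih i hi; omega
        obtain ⟨i, hi, h1, h2⟩ := next_eq hG h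
        have : #{i ∈ range n | segStart G n d (p + 1) < d i} <
            #{i ∈ range n | segStart G n d p < d i} := by
          refine card_lt_card ⟨fun j hj => ?_, fun hsub => ?_⟩
          · simp only [mem_filter] at hj ⊢
            exact ⟨hj.1, (segStart_mono hG (Nat.le_succ p)).trans_lt hj.2⟩
          · have := hsub (mem_filter.2 ⟨mem_range.2 hi, h1⟩)
            rw [mem_filter] at this
            exact absurd h2 (ne_of_lt this.2)
        omega
      · left
        push Not at h
        exact fun i hi => (h i hi).trans (segStart_mono hG (Nat.le_succ p))
  rcases key n with h | h
  · exact h i hi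
  · by_contra! hlt
    have : 0 < #{i ∈ range n | segStart G n d n < d i} :=
      card_pos.2 ⟨i, mem_filter.2 ⟨mem_range.2 hi, hlt⟩⟩
    omega

theorem exists_segStart_eq (hG : ∀ i < n, d i < 2 ^ G) (i : ℕ) (hi : i < n) :
    ∃ q ≤ n, segStart G n d q = d i := by
  have hex : ∃ q, d i ≤ segStart G n d q := ⟨n, le_segStart hG i hi⟩
  refine ⟨Nat.find hex, Nat.find_min' hex (le_segStart hG i hi), ?_⟩
  have h1 := Nat.find_spec hex
  have h2 := fun m => Nat.find_min hex (m := m)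
  generalize Nat.find hex = q at *
  cases q with
  | zero => have : segStart G n d 0 = 0 := rfl
            omega
  | succ q =>
    have := h2 q (by omega)
    exact le_antisymm (next_le (τ := segStart G n d q) i hi (by omega)) h1

end Segments

/-! ### The schedule -/

/-- The number of positions below `P` in column `u` when the positions `0, 1, 2, …` are arranged
in rows of length `l`. -/
def column (l P u : ℕ) : ℕ := P / l + if u < P % l then 1 else 0

theorem column_mono {l : ℕ} {P P' : ℕ} (h : P ≤ P') (u : ℕ) : column l P u ≤ column l P' u := by
  have h1 := Nat.div_le_div_right (c := l) h
  rcases h1.eq_or_lt with h2 | h2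
  · have h3 := Nat.div_add_mod P l
    have h4 := Nat.div_add_mod P' l
    rw [h2] at h3
    simp only [column, h2]
    split_ifs <;> omega
  · simp only [column]
    split_ifs <;> omega

theorem column_add_mul {l : ℕ} (hl : 0 < l) (P m u : ℕ) :
    column l (P + m * l) u = column l P u + m := by
  simp only [column, Nat.add_mul_div_right _ _ hl, Nat.add_mul_mod_self_right]
  ring

theorem sum_column {l : ℕ} (hl : 0 < l) (P : ℕ) : ∑ u ∈ range l, column l P u = P := by
  have h1 : ∑ u ∈ range l, (if u < P % l then 1 else 0) = P % l := by
    rw [← card_filter]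
    have : {u ∈ range l | u < P % l} = range (P % l) := by
      ext u
      have := Nat.mod_lt P hl
      simp only [mem_filter, mem_range]; omega
    rw [this, card_range]
  simp only [column, sum_add_distrib, h1, sum_const, card_range, smul_eq_mul]
  exact Nat.div_add_mod P l

theorem column_mul {l : ℕ} (hl : 0 < l) (m u : ℕ) : column l (m * l) u = m := by
  have := column_add_mul hl 0 m u
  simpa [column] using this

/-- The work that is left at the beginning of segment `p`. -/
def rest (G n C : ℕ) (k d D : ℕ → ℕ) (p : ℕ) : ℕ → ℕ :=
  Nat.rec D (fun p R i => R i - allot G n C k d R (segStart G n d (p + 1) - segStart G n d p) i) p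

/-- The work of task `i` in segment `p`. -/
def share (G n C : ℕ) (k d D : ℕ → ℕ) (p i : ℕ) : ℕ :=
  allot G n C k d (rest G n C k d D p) (segStart G n d (p + 1) - segStart G n d p) i

/-- The number of machines for task `i` in slot `t`. -/
def machines (G n C : ℕ) (k d D : ℕ → ℕ) (i t : ℕ) : ℕ :=
  ∑ p ∈ range n, if segStart G n d p < t ∧ t ≤ segStart G n d (p + 1) then
    column (segStart G n d (p + 1) - segStart G n d p) (∑ j ∈ range (i + 1), share G n C k d D p j)
      (t - 1 - segStart G n d p) -
    column (segStart G n d (p + 1) - segStart G n d p) (∑ j ∈ range i, share G n C k d D p j)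
      (t - 1 - segStart G n d p) else 0

section Schedule

variable {G n C : ℕ} {k d D : ℕ → ℕ}

theorem rest_eq (p i : ℕ) :
    rest G n C k d D p i = D i - ∑ q ∈ range p, share G n C k d D q i := by
  induction p with
  | zero => rfl
  | succ p ih => rw [sum_range_succ, ← Nat.sub_sub, ← ih]; rfl

theorem hall_rest (hH : Hall n C k d D 0) (hG : ∀ i < n, d i < 2 ^ G) (p : ℕ) :
    Hall n C k d (rest G n C k d D p) (segStart G n d p) := by
  induction p with
  | zero => exact hH
  | succ p ih =>
    have h1 := ih.step (l := segStart G n d (p + 1) - segStart G n d p) hG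
    rwa [Nat.add_sub_cancel' (segStart_mono hG (Nat.le_succ p))] at h1

/-- The intervals between consecutive values of `T` are half-open and disjoint, so at most one term
is counted. -/
theorem sum_segments_le {T : ℕ → ℕ} (hT : Monotone T) (t B : ℕ) (F : ℕ → ℕ)
    (hF : ∀ p, T p < t → t ≤ T (p + 1) → F p ≤ B) (n : ℕ) :
    ∑ p ∈ range n, (if T p < t ∧ t ≤ T (p + 1) then F p else 0) ≤ B := by
  by_cases h : ∃ p, T p < t ∧ t ≤ T (p + 1)
  · obtain ⟨p, hp1, hp2⟩ := h
    refine (sum_le_sum_of_subset (range_mono (show n ≤ max n (p + 1) by omega))).trans ?_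
    rw [sum_eq_single_of_mem p (mem_range.2 (by omega)) fun q _ hq => if_neg fun hh => ?_]
    · rw [if_pos ⟨hp1, hp2⟩]; exact hF p hp1 hp2
    · rcases lt_or_gt_of_ne hq with h | h
      · have := hT (show q + 1 ≤ p by omega); omega
      · have := hT (show p + 1 ≤ q by omega); omega
  · push Not at h
    rw [sum_eq_zero fun p _ => if_neg fun hh => absurd hh.2 (not_le.2 (h p hh.1))]
    exact Nat.zero_le _

/-- The share is at most `k i * l`, that is `k i` full rows, and each full row meets a column once.
-/
theorem machines_le (hG : ∀ i < n, d i < 2 ^ G) (i t : ℕ) : machines G n C k d D i t ≤ k i := by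
  refine sum_segments_le (segStart_mono hG) t _ _ (fun p hp1 hp2 => ?_) n
  have hl : 0 < segStart G n d (p + 1) - segStart G n d p := by omega
  rw [Nat.sub_le_iff_le_add, add_comm (k i), ← column_add_mul hl, sum_range_succ]
  exact column_mono (Nat.add_le_add_left (allot_le_bound i) _) _

/-- In one column the counts telescope to the number of positions used, and all positions fit into
`C` rows. -/
theorem sum_machines_le (hH : Hall n C k d D 0) (hG : ∀ i < n, d i < 2 ^ G) (t : ℕ) :
    ∑ i ∈ range n, machines G n C k d D i t ≤ C := by
  simp only [machines]
  rw [sum_comm]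
  have e : ∀ (c : Prop) [Decidable c] (F : ℕ → ℕ), (∑ i ∈ range n, if c then F i else 0) =
      if c then ∑ i ∈ range n, F i else 0 := fun c _ F => by split_ifs <;> simp
  simp only [e]
  refine sum_segments_le (segStart_mono hG) t _ _ (fun p hp1 hp2 => ?_) n
  have hl : 0 < segStart G n d (p + 1) - segStart G n d p := by omega
  rw [sum_range_tsub (f := fun i => column (segStart G n d (p + 1) - segStart G n d p)
    (∑ j ∈ range i, share G n C k d D p j) (t - 1 - segStart G n d p))
    (fun a b h => column_mono (sum_le_sum_of_subset (range_mono h)) _)]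
  refine (Nat.sub_le _ _).trans ?_
  conv_rhs => rw [← column_mul hl C (t - 1 - segStart G n d p)]
  refine column_mono ?_ _
  exact (sum_allot (hall_rest hH hG p)).le.trans (min_le_left _ _)

/-- A segment starts at `d i`. There `Hall` with `s = τ = d i` has right-hand side `0`, which forces
the rest of task `i` to vanish. -/
theorem le_sum_machines (hH : Hall n C k d D 0) (hG : ∀ i < n, d i < 2 ^ G) (i : ℕ) (hi : i < n) :
    D i ≤ ∑ t ∈ Icc 1 (d i), machines G n C k d D i t := by
  obtain ⟨q, hq, hqd⟩ := exists_segStart_eq hG i hi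
  have h1 : rest G n C k d D q i = 0 := by
    have := hall_rest hH hG q (d i) hqd.le
    rw [hqd, Nat.sub_self, mul_zero, Nat.le_zero, sum_eq_zero_iff] at this
    simpa using this i (mem_range.2 hi)
  rw [rest_eq] at h1
  refine (show D i ≤ ∑ p ∈ range q, share G n C k d D p i by omega).trans ?_
  simp only [machines]
  rw [sum_comm]
  refine le_trans ?_ (sum_le_sum_of_subset (range_mono hq))
  refine sum_le_sum fun p hp => ?_
  have hmono := segStart_mono (n := n) hG
  have hp1 : segStart G n d p ≤ segStart G n d (p + 1) := hmono (Nat.le_succ p)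
  have hp2 : segStart G n d (p + 1) ≤ d i := hqd ▸ hmono (mem_range.1 hp)
  rw [← sum_filter]
  have e : {t ∈ Icc 1 (d i) | segStart G n d p < t ∧ t ≤ segStart G n d (p + 1)} =
      (range (segStart G n d (p + 1) - segStart G n d p)).image (· + (segStart G n d p + 1)) := by
    ext t
    simp only [mem_filter, mem_Icc, mem_image, mem_range]
    constructor
    · rintro ⟨_, h2, h3⟩
      exact ⟨t - (segStart G n d p + 1), by omega, by omega⟩
    · rintro ⟨u, h2, rfl⟩
      omega
  rw [e, sum_image fun a _ b _ h => Nat.add_right_cancel h]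
  rcases Nat.eq_zero_or_pos (segStart G n d (p + 1) - segStart G n d p) with hl | hl
  · have : share G n C k d D p i ≤ k i * (segStart G n d (p + 1) - segStart G n d p) :=
      allot_le_bound i
    rw [hl, mul_zero] at this
    omega
  · have h2 := sum_column hl (∑ j ∈ range (i + 1), share G n C k d D p j)
    have h3 := sum_column hl (∑ j ∈ range i, share G n C k d D p j)
    have h4 := sum_range_succ (fun j => share G n C k d D p j) i
    have h5 : ∀ u, u + (segStart G n d p + 1) - 1 - segStart G n d p = u := fun u => by omega
    simp only [h5]
    generalize ∑ j ∈ range (i + 1), share G n C k d D p j = P' at *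
    generalize ∑ j ∈ range i, share G n C k d D p j = P at *
    generalize segStart G n d (p + 1) - segStart G n d p = l at *
    have h6 : ∑ u ∈ range l, column l P' u ≤
        ∑ u ∈ range l, (column l P' u - column l P u) + ∑ u ∈ range l, column l P u := by
      rw [← sum_add_distrib]
      exact sum_le_sum fun u _ => by omega
    omega

end Schedule

/-! ### The optimal value -/

/-- The last time `t` with `W i * t + c i ≤ lam`. -/
def deadline (G : ℕ) (W c : ℕ → ℕ) (lam i : ℕ) : ℕ := srch G fun t => lam + 1 - (W i * t + c i)

/-- This vanishes if and only if all tasks can meet the deadlines that belong to `lam`. -/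
def violation (G n C : ℕ) (k D W c : ℕ → ℕ) (lam : ℕ) : ℕ :=
  ∑ j ∈ range n, ((D j - k j * deadline G W c lam j) +
    (∑ i ∈ range n, (D i - k i * (deadline G W c lam i - deadline G W c lam j)) -
      C * deadline G W c lam j))

/-- Success at `x` means that `x - 1` is infeasible. With this shift the last success is a feasible
value whose predecessor is infeasible. -/
def optimum (H G n C : ℕ) (k D W c : ℕ → ℕ) : ℕ :=
  srch H fun x => violation G n C k D W c (x - 1)

section Optimum

variable {G H n C : ℕ} {k D W c : ℕ → ℕ} {lam : ℕ}

theorem deadline_lt (i : ℕ) : deadline G W c lam i < 2 ^ G := srch_lt _ _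

theorem le_deadline {i t : ℕ} (ht : t < 2 ^ G) (h : W i * t + c i ≤ lam) :
    t ≤ deadline G W c lam i :=
  le_srch ht fun y hy => by
    have := Nat.mul_le_mul_left (W i) hy
    omega

theorem deadline_spec (i : ℕ) : deadline G W c lam i = 0 ∨
    W i * deadline G W c lam i + c i ≤ lam := by
  rcases (srch_spec G fun t => lam + 1 - (W i * t + c i)).2.1 with h | h
  · exact .inl h
  · exact .inr (by unfold deadline; omega)

theorem violation_eq_zero : violation G n C k D W c lam = 0 ↔ ∀ j < n,
    D j ≤ k j * deadline G W c lam j ∧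
    ∑ i ∈ range n, (D i - k i * (deadline G W c lam i - deadline G W c lam j)) ≤
      C * deadline G W c lam j := by
  rw [violation, sum_eq_zero_iff]
  simp only [mem_range]
  exact forall₂_congr fun j _ => by omega

theorem hall_of_violation (h : violation G n C k D W c lam = 0) :
    Hall n C k (deadline G W c lam) D 0 := by
  rw [violation_eq_zero] at h
  exact hall_of_deadlines (fun j hj => (h j hj).1) fun j hj => (h j hj).2

/-- All deadlines are at least `∑ D i`, enough time for all work on a single machine. -/
theorem violation_of_large (hC : 0 < C) (hk : ∀ i < n, 0 < k i)
    (hG : ∑ i ∈ range n, D i < 2 ^ G) (h : ∀ j < n, W j * (∑ i ∈ range n, D i) + c j ≤ lam) :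
    violation G n C k D W c lam = 0 := by
  rw [violation_eq_zero]
  intro j hj
  have h1 := le_deadline hG (h j hj)
  have h2 : D j ≤ ∑ i ∈ range n, D i := single_le_sum (f := D) (fun _ _ => Nat.zero_le _)
    (mem_range.2 hj)
  have h3 := Nat.le_mul_of_pos_left (deadline G W c lam j) (hk j hj)
  have h4 := Nat.le_mul_of_pos_left (deadline G W c lam j) hC
  have h5 : ∑ i ∈ range n, (D i - k i * (deadline G W c lam i - deadline G W c lam j)) ≤
    ∑ i ∈ range n, D i := sum_le_sum fun i _ => Nat.sub_le _ _
  omega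

theorem violation_of_schedule (hC : 0 < C) (hk : ∀ i < n, 0 < k i) (hlam : lam < 2 ^ H)
    (hG : 2 ^ H + ∑ i ∈ range n, D i < 2 ^ G) (y : ℕ → ℕ → ℕ) (T : ℕ → ℕ)
    (hyk : ∀ i < n, ∀ t, 1 ≤ t → y i t ≤ k i) (hyC : ∀ t, 1 ≤ t → ∑ i ∈ range n, y i t ≤ C)
    (hyD : ∀ i < n, D i ≤ ∑ t ∈ Icc 1 (T i), y i t) (hT : ∀ i < n, W i * T i + c i ≤ lam) :
    violation G n C k D W c lam = 0 := by
  rw [violation_eq_zero]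
  have hbd : ∀ i < n, ∀ a b, a ≤ b →
      ∑ t ∈ Icc 1 b, y i t ≤ ∑ t ∈ Icc 1 a, y i t + k i * (b - a) := by
    intro i hi a b hab
    have : Icc 1 b = Icc 1 a ∪ Icc (a + 1) b := by
      ext t; simp only [mem_union, mem_Icc]; omega
    rw [this, sum_union (disjoint_left.2 fun t => by simp only [mem_Icc]; omega)]
    refine Nat.add_le_add_left ?_ _
    refine (sum_le_card_nsmul _ _ (k i) fun t ht => hyk i hi t ?_).trans ?_
    · have := (mem_Icc.1 ht).1; omega
    · simp [mul_comm]
  -- A task of weight `0` has no real deadline and gets the cap `2 ^ G - 1`; the other deadlines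
  -- stay below `2 ^ H`.
  have hcase : ∀ i < n, deadline G W c lam i + 1 = 2 ^ G ∨
      (T i ≤ deadline G W c lam i ∧ deadline G W c lam i < 2 ^ H) := by
    intro i hi
    have h1 := hT i hi
    rcases Nat.eq_zero_or_pos (W i) with h0 | h0
    · left
      have h2 : 2 ^ G - 1 ≤ deadline G W c lam i :=
        le_deadline (by have := Nat.two_pow_pos G; omega) (by rw [h0] at h1 ⊢; omega)
      have := deadline_lt (G := G) (W := W) (c := c) (lam := lam) i
      omega
    · right
      have h2 := Nat.le_mul_of_pos_left (T i) h0
      refine ⟨le_deadline (by omega) h1, ?_⟩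
      have h3 := Nat.le_mul_of_pos_left (deadline G W c lam i) h0
      rcases deadline_spec (G := G) (W := W) (c := c) (lam := lam) i with h | h <;> omega
  have hDle : ∀ j < n, D j ≤ ∑ i ∈ range n, D i := fun j hj =>
    single_le_sum (f := D) (fun _ _ => Nat.zero_le _) (mem_range.2 hj)
  intro j hj
  have h3 := Nat.le_mul_of_pos_left (deadline G W c lam j) (hk j hj)
  have h4 := Nat.le_mul_of_pos_left (deadline G W c lam j) hC
  have h5 := hDle j hj
  rcases hcase j hj with h | ⟨h, h'⟩
  · have h6 : ∑ i ∈ range n, (D i - k i * (deadline G W c lam i - deadline G W c lam j)) ≤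
      ∑ i ∈ range n, D i := sum_le_sum fun i _ => Nat.sub_le _ _
    omega
  · refine ⟨?_, ?_⟩
    · have h6 := hbd j hj 0 (T j) (Nat.zero_le _)
      have h7 := Nat.mul_le_mul_left (k j) h
      have h8 := hyD j hj
      simp at h6
      omega
    · calc _ ≤ ∑ i ∈ range n, ∑ t ∈ Icc 1 (deadline G W c lam j), y i t := by
            refine sum_le_sum fun i hi => ?_
            have hi := mem_range.1 hi
            have h6 := hDle i hi
            -- If `d i` is the cap, its distance to `d j < 2 ^ H` exceeds `∑ D`, so task `i`
            -- requires nothing by `d j`. Otherwise `y` executes at most `k i` per slot after `d j`,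
            -- and the required work is done before.
            rcases hcase i hi with h7 | ⟨h7, -⟩
            · have h8 := Nat.le_mul_of_pos_left (deadline G W c lam i - deadline G W c lam j)
                (hk i hi)
              omega
            · have h8 := hyD i hi
              have h9 := hbd i hi (min (deadline G W c lam j) (T i)) (T i) (min_le_right _ _)
              have h10 : k i * (T i - min (deadline G W c lam j) (T i)) ≤
                k i * (deadline G W c lam i - deadline G W c lam j) :=
                Nat.mul_le_mul_left _ (by omega)
              have h11 : ∑ t ∈ Icc 1 (min (deadline G W c lam j) (T i)), y i t ≤
                  ∑ t ∈ Icc 1 (deadline G W c lam j), y i t :=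
                sum_le_sum_of_subset (Icc_subset_Icc_right (min_le_left _ _))
              omega
        _ = ∑ t ∈ Icc 1 (deadline G W c lam j), ∑ i ∈ range n, y i t := sum_comm
        _ ≤ ∑ t ∈ Icc 1 (deadline G W c lam j), C :=
            sum_le_sum fun t ht => hyC t (mem_Icc.1 ht).1
        _ = _ := by simp [mul_comm]

theorem violation_optimum
    (hlarge : violation G n C k D W c (2 ^ H - 1) = 0) :
    violation G n C k D W c (optimum H G n C k D W c) = 0 := by
  rcases (srch_spec H fun x => violation G n C k D W c (x - 1)).2.2 with h | h
  · rw [optimum]; rwa [← h] at hlarge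
  · exact h

theorem optimum_le (h : violation G n C k D W c (optimum H G n C k D W c - 1) = 0) :
    optimum H G n C k D W c = 0 := by
  rcases (srch_spec H fun x => violation G n C k D W c (x - 1)).2.1 with h1 | h1
  · exact h1
  · exact absurd h h1

end Optimum

/-! ### The data of the algorithm

`K` is a bound on the lengths of all numbers that occur, and `m` is the content of the memory. -/

/-- The cutoffs by `K` here and below make every quantity computable in polynomial time for
arbitrary memory contents. On a genuine input they have no effect. -/
def numTasks (K : ℕ) (m : ℕ → ℕ) : ℕ := min (m 0) K

def numMachines (K : ℕ) (m : ℕ → ℕ) : ℕ := m 1 % 2 ^ K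

def demandAt (K : ℕ) (m : ℕ → ℕ) (i : ℕ) : ℕ := if i < numTasks K m then m (4 + 5 * i) else 0

def boundAt (K : ℕ) (m : ℕ → ℕ) (i : ℕ) : ℕ :=
  if i < numTasks K m then m (4 + 5 * i + 1) % 2 ^ K else 0

/-- The due date of task `i`, or `0` if due dates are to be ignored. -/
def dueAt (late : Bool) (K : ℕ) (m : ℕ → ℕ) (i : ℕ) : ℕ :=
  if late then m (4 + 5 * i + 4) % 2 ^ K else 0

/-- The weight of task `i` times the product of all denominators of weights. -/
def weightAt (K : ℕ) (m : ℕ → ℕ) (i : ℕ) : ℕ :=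
  if i < numTasks K m then ∏ j ∈ range (numTasks K m),
    ((if j = i then m (4 + 5 * i + 2) else m (4 + 5 * j + 3)) % 2 ^ K) else 0

def dueSum (late : Bool) (K : ℕ) (m : ℕ → ℕ) : ℕ :=
  ∑ i ∈ range (numTasks K m), weightAt K m i * dueAt late K m i

/-- The shift by `dueSum` is the same for all tasks and makes lateness a natural number. -/
def offsetAt (late : Bool) (K : ℕ) (m : ℕ → ℕ) (i : ℕ) : ℕ :=
  if i < numTasks K m then dueSum late K m - weightAt K m i * dueAt late K m i else 0

/-- Values get `K / 4` bits and times `K / 2`, so that the cap on times lies far above all finite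
deadlines. -/
def valueOf (late : Bool) (K : ℕ) (m : ℕ → ℕ) : ℕ :=
  optimum (K / 2 / 2) (K / 2) (numTasks K m) (numMachines K m) (boundAt K m) (demandAt K m)
    (weightAt K m) (offsetAt late K m)

def deadlineAt (late : Bool) (K : ℕ) (m : ℕ → ℕ) (i : ℕ) : ℕ :=
  deadline (K / 2) (weightAt K m) (offsetAt late K m) (valueOf late K m) i

def startAt (late : Bool) (K : ℕ) (m : ℕ → ℕ) (p : ℕ) : ℕ :=
  segStart (K / 2) (numTasks K m) (deadlineAt late K m) (min p K)

def lengthAt (late : Bool) (K : ℕ) (m : ℕ → ℕ) (p : ℕ) : ℕ :=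
  startAt late K m (p + 1) - startAt late K m p

/-- The work that is left at the beginning of segment `p`; the work of task `i` in segment `q` is
stored in the memory cell `K + q * K + i`. -/
def restAt (K : ℕ) (m : ℕ → ℕ) (p i : ℕ) : ℕ :=
  if i < numTasks K m then demandAt K m i - ∑ q ∈ range (min p K), m (K + q * K + i) else 0

def shareAt (late : Bool) (K : ℕ) (m : ℕ → ℕ) (p i : ℕ) : ℕ :=
  allot (K / 2) (numTasks K m) (numMachines K m) (boundAt K m) (deadlineAt late K m)
    (restAt K m p) (lengthAt late K m p) (min i K)

def shareCell (late : Bool) (K : ℕ) (m : ℕ → ℕ) (q : ℕ) : ℕ :=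
  shareAt late K m (q % 2 ^ K / K) (q % 2 ^ K % K)

def positionAt (K : ℕ) (m : ℕ → ℕ) (p i : ℕ) : ℕ :=
  (∑ j ∈ range (min i K), m (K + p * K + j)) % 2 ^ K

/-- The columns at which the number of machines of a task changes. -/
def splitAt (l P P' b : ℕ) : ℕ :=
  if b = 0 then 0 else if b = 1 then min (P % l) (P' % l) else
    if b = 2 then max (P % l) (P' % l) else l

/-- Entry `f` of block `b` of task `i` in segment `p`. -/
def blockEntry (n l τ P P' p i b f : ℕ) : ℕ :=
  if f = 0 then i else if f = 1 then τ + splitAt l P P' b + 1 else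
    if f = 2 then τ + splitAt l P P' (b + 1) else
      if p < n then if i < n then if 0 < l then
        column l P' (splitAt l P P' b) - column l P (splitAt l P P' b) else 0 else 0 else 0

/-- A pair of segment and task occupies `12` cells: three blocks of four entries. -/
def blockCell (late : Bool) (K : ℕ) (m : ℕ → ℕ) (q : ℕ) : ℕ :=
  blockEntry (numTasks K m) (lengthAt late K m (q % 2 ^ K / 12 / K))
    (startAt late K m (q % 2 ^ K / 12 / K))
    (positionAt K m (q % 2 ^ K / 12 / K) (q % 2 ^ K / 12 % K))
    (positionAt K m (q % 2 ^ K / 12 / K) (q % 2 ^ K / 12 % K + 1))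
    (q % 2 ^ K / 12 / K) (q % 2 ^ K / 12 % K) (q % 2 ^ K / 4 % 3) (q % 2 ^ K % 4)

/-! ### The data of the algorithm are computable in polynomial time -/

namespace Computes

variable {d : ℕ} {f g u v w P P' : State → ℕ}

theorem max (hf : Computes d f) (hg : Computes d g) : Computes d fun s => max (f s) (g s) :=
  (hf.add (hg.sub hf)).of_eq fun s => by omega

theorem mul_of_lt (hf : Computes d f) (hg : Computes d g) (hlt : ∀ s, g s < 2 ^ s.reg 2) :
    Computes d fun s => f s * g s :=
  (hf.mul hg).of_eq fun s => by rw [Nat.mod_eq_of_lt (hlt s)]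

theorem mod_two_pow (hf : Computes d f) : Computes d fun s => f s % 2 ^ s.reg 2 :=
  ((const hf.three_le 1).mul hf).of_eq fun s => by rw [one_mul]

theorem div_of_lt (hf : Computes d f) (hg : Computes d g) (hlt : ∀ s, f s < 2 ^ s.reg 2) :
    Computes d fun s => f s / g s :=
  (hf.div hg).of_eq fun s => by rw [Nat.mod_eq_of_lt (hlt s)]

theorem mod_of_lt (hf : Computes d f) (hg : Computes d g) (hlt : ∀ s, f s < 2 ^ s.reg 2) :
    Computes d fun s => f s % g s :=
  (hf.sub (hg.mul_of_lt (hf.div_of_lt hg hlt) fun s => (Nat.div_le_self _ _).trans_lt (hlt s))).of_eq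
    fun s => by rw [Nat.mod_def]

theorem sum_of_le {φ : State → ℕ → ℕ} (hf : Computes d f) (hle : ∀ s, f s ≤ s.reg 2)
    (hφ : Closed d φ) : Computes d fun s => ∑ j ∈ range (f s), φ s j :=
  (sum hf hφ).of_eq fun s => by rw [min_eq_left (hle s)]

theorem prod_of_le {φ : State → ℕ → ℕ} (hf : Computes d f) (hle : ∀ s, f s ≤ s.reg 2)
    (hφ : Closed d φ) : Computes d fun s => ∏ j ∈ range (f s), (φ s j % 2 ^ s.reg 2) :=
  (prod hf hφ).of_eq fun s => by rw [min_eq_left (hle s)]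

theorem numTasks (hd : 3 ≤ d) : Computes d fun s => numTasks (s.reg 2) s.mem :=
  ((const hd 0).load).min (bits hd)

theorem numTasks_le (s : State) : Malleable.numTasks (s.reg 2) s.mem ≤ s.reg 2 := min_le_right _ _

theorem numMachines (hd : 3 ≤ d) : Computes d fun s => numMachines (s.reg 2) s.mem :=
  ((const hd 1).load).mod_two_pow

theorem numMachines_lt (s : State) : Malleable.numMachines (s.reg 2) s.mem < 2 ^ s.reg 2 :=
  Nat.mod_lt _ (Nat.two_pow_pos _)

theorem input (hu : Computes d u) (r : ℕ) : Computes d fun s => s.mem (4 + 5 * u s + r) :=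
  (((((((hu.add hu).add hu).add hu).add hu).add (const hu.three_le (4 + r)))).load).of_eq
    fun s => by congr 1; ring

theorem demandAt (hu : Computes d u) : Computes d fun s => demandAt (s.reg 2) s.mem (u s) :=
  hu.ite_lt (numTasks hu.three_le) (hu.input 0) (const hu.three_le 0)

theorem boundAt (hu : Computes d u) : Computes d fun s => boundAt (s.reg 2) s.mem (u s) :=
  hu.ite_lt (numTasks hu.three_le) (hu.input 1).mod_two_pow (const hu.three_le 0)

theorem boundAt_lt (s : State) (i : ℕ) : Malleable.boundAt (s.reg 2) s.mem i < 2 ^ s.reg 2 := by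
  unfold Malleable.boundAt
  split_ifs
  · exact Nat.mod_lt _ (Nat.two_pow_pos _)
  · exact Nat.two_pow_pos _

theorem dueAt (late : Bool) (hu : Computes d u) :
    Computes d fun s => dueAt late (s.reg 2) s.mem (u s) := by
  cases late
  · exact const hu.three_le 0
  · exact (hu.input 4).mod_two_pow

theorem dueAt_lt (late : Bool) (s : State) (i : ℕ) :
    Malleable.dueAt late (s.reg 2) s.mem i < 2 ^ s.reg 2 := by
  cases late
  · exact Nat.two_pow_pos _
  · exact Nat.mod_lt _ (Nat.two_pow_pos _)

theorem weightAt (hu : Computes d u) : Computes d fun s => weightAt (s.reg 2) s.mem (u s) :=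
  hu.ite_lt (numTasks hu.three_le) (prod_of_le (φ := fun s j =>
    if j = u s then s.mem (4 + 5 * u s + 2) else s.mem (4 + 5 * j + 3)) (numTasks hu.three_le)
    numTasks_le fun _ he _ hx => hx.ite_eq (hu.mono he) ((hu.mono he).input 2) (hx.input 3))
    (const hu.three_le 0)

theorem dueSum (late : Bool) (hd : 3 ≤ d) : Computes d fun s => dueSum late (s.reg 2) s.mem :=
  sum_of_le (numTasks hd) numTasks_le fun _ _ _ hx =>
    hx.weightAt.mul_of_lt (hx.dueAt late) fun s => dueAt_lt late s _

theorem offsetAt (late : Bool) (hu : Computes d u) :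
    Computes d fun s => offsetAt late (s.reg 2) s.mem (u s) :=
  hu.ite_lt (numTasks hu.three_le) ((dueSum late hu.three_le).sub
    (hu.weightAt.mul_of_lt (hu.dueAt late) fun s => dueAt_lt late s _)) (const hu.three_le 0)

theorem deadline (late : Bool) (hu : Computes d u) (hv : Computes d v) :
    Computes d fun s => deadline (s.reg 2 / 2) (Malleable.weightAt (s.reg 2) s.mem)
      (Malleable.offsetAt late (s.reg 2) s.mem) (u s) (v s) :=
  (srch (φ := fun s t => u s + 1 - (Malleable.weightAt (s.reg 2) s.mem (v s) * (t % 2 ^ s.reg 2) +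
    Malleable.offsetAt late (s.reg 2) s.mem (v s))) (bits hu.three_le).half
    (fun s => Nat.div_le_self _ _) fun e he _ hx =>
      ((hu.mono he).add (const (hu.three_le.trans he) 1)).sub (((hv.mono he).weightAt.mul hx).add
        ((hv.mono he).offsetAt late))).of_eq
    fun s => srch_congr fun x hx => by
      rw [Nat.mod_eq_of_lt (hx.trans_le (Nat.pow_le_pow_right two_pos (Nat.div_le_self _ _)))]

theorem violation (late : Bool) (hu : Computes d u) :
    Computes d fun s => violation (s.reg 2 / 2) (Malleable.numTasks (s.reg 2) s.mem)
      (Malleable.numMachines (s.reg 2) s.mem) (Malleable.boundAt (s.reg 2) s.mem)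
      (Malleable.demandAt (s.reg 2) s.mem) (Malleable.weightAt (s.reg 2) s.mem)
      (Malleable.offsetAt late (s.reg 2) s.mem) (u s) := by
  have hd := hu.three_le
  -- Multiplication truncates its right factor, so the factor known to be below `2 ^ K` is put
  -- there.
  have key : ∀ e, d ≤ e → ∀ x y, Computes e x → Computes e y →
      Computes e fun s => Malleable.boundAt (s.reg 2) s.mem (x s) * y s := fun e he x y hx hy =>
    (hy.mul_of_lt hx.boundAt fun s => boundAt_lt s _).of_eq fun s => mul_comm _ _
  refine sum_of_le (numTasks hd) numTasks_le fun e he x hx => ?_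
  have hdx := (hu.mono he).deadline late hx
  refine (hx.demandAt.sub (key e he _ _ hx hdx)).add (Computes.sub (sum_of_le
    (numTasks (hd.trans he)) numTasks_le fun e' he' y hy => ?_) ?_)
  · exact hy.demandAt.sub (key e' (he.trans he') _ _ hy
      (((hu.mono (he.trans he')).deadline late hy).sub (hdx.mono he')))
  · exact (hdx.mul_of_lt (numMachines (hd.trans he)) numMachines_lt).of_eq fun s => mul_comm _ _

theorem valueOf (late : Bool) (hd : 3 ≤ d) : Computes d fun s => valueOf late (s.reg 2) s.mem :=
  srch (φ := fun s x => Malleable.violation (s.reg 2 / 2) (Malleable.numTasks (s.reg 2) s.mem)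
      (Malleable.numMachines (s.reg 2) s.mem) (Malleable.boundAt (s.reg 2) s.mem)
      (Malleable.demandAt (s.reg 2) s.mem) (Malleable.weightAt (s.reg 2) s.mem)
      (Malleable.offsetAt late (s.reg 2) s.mem) (x - 1))
    (bits hd).half.half (fun s => by omega) fun _ he _ hx =>
    (hx.sub (const (hd.trans he) 1)).violation late

theorem deadlineAt (late : Bool) (hu : Computes d u) :
    Computes d fun s => deadlineAt late (s.reg 2) s.mem (u s) :=
  (valueOf late hu.three_le).deadline late hu

theorem startAt (late : Bool) (hu : Computes d u) :
    Computes d fun s => startAt late (s.reg 2) s.mem (u s) :=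
  iter_min (φ := fun s _ τ => next (s.reg 2 / 2) (Malleable.numTasks (s.reg 2) s.mem)
    (Malleable.deadlineAt late (s.reg 2) s.mem) τ) hu (const hu.three_le 0)
    fun _ he _ _ _ hτ => srch (bits (hu.three_le.trans he)).half (fun _ => Nat.div_le_self _ _)
      fun _ he' _ hx => (const (hx.three_le) 1).sub (sum_of_le (numTasks hx.three_le) numTasks_le
        fun _ he'' _ hy => ((hτ.mono he').mono he'').ite_lt (hy.deadlineAt late)
          ((hy.deadlineAt late).ite_lt (hx.mono he'') (const hy.three_le 1) (const hy.three_le 0))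
          (const hy.three_le 0))

theorem lengthAt (late : Bool) (hu : Computes d u) :
    Computes d fun s => lengthAt late (s.reg 2) s.mem (u s) :=
  ((hu.add (const hu.three_le 1)).startAt late).sub (hu.startAt late)

theorem shareLoad (hu : Computes d u) (hv : Computes d v) :
    Computes d fun s => s.mem (s.reg 2 + u s * s.reg 2 + v s) :=
  (((bits hu.three_le).add (hu.mul_of_lt (bits hu.three_le) fun _ => Nat.lt_two_pow_self)).add
    hv).load

theorem restAt (hu : Computes d u) (hv : Computes d v) :
    Computes d fun s => restAt (s.reg 2) s.mem (u s) (v s) :=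
  hv.ite_lt (numTasks hv.three_le) (hv.demandAt.sub (sum hu fun _ he _ hx =>
    hx.shareLoad (hv.mono he))) (const hv.three_le 0)

theorem urgent (late : Bool) (hu : Computes d u) (hv : Computes d v) (hw : Computes d w) :
    Computes d fun s => urgent (Malleable.boundAt (s.reg 2) s.mem)
      (Malleable.deadlineAt late (s.reg 2) s.mem) (Malleable.restAt (s.reg 2) s.mem (u s))
      (Malleable.lengthAt late (s.reg 2) s.mem (u s)) (v s) (w s) := by
  have key : ∀ y, Computes d y → Computes d fun s =>
      Malleable.boundAt (s.reg 2) s.mem (v s) * y s := fun y hy =>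
    (hy.mul_of_lt hv.boundAt fun s => boundAt_lt s _).of_eq fun s => mul_comm _ _
  exact ((hu.restAt hv).sub (key _ ((hv.deadlineAt late).sub hw))).min (key _ (hu.lengthAt late))

theorem urgentSum (late : Bool) (hu : Computes d u) (hw : Computes d w) :
    Computes d fun s => urgentSum (Malleable.numTasks (s.reg 2) s.mem)
      (Malleable.boundAt (s.reg 2) s.mem)
      (Malleable.deadlineAt late (s.reg 2) s.mem) (Malleable.restAt (s.reg 2) s.mem (u s))
      (Malleable.lengthAt late (s.reg 2) s.mem (u s)) (w s) :=
  sum_of_le (numTasks hu.three_le) numTasks_le fun _ he _ hx =>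
    (hu.mono he).urgent late hx (hw.mono he)

theorem machineTime (late : Bool) (hu : Computes d u) :
    Computes d fun s => Malleable.numMachines (s.reg 2) s.mem *
      Malleable.lengthAt late (s.reg 2) s.mem (u s) :=
  ((hu.lengthAt late).mul_of_lt (numMachines hu.three_le) numMachines_lt).of_eq
    fun _ => mul_comm _ _

theorem threshold (late : Bool) (hu : Computes d u) :
    Computes d fun s => threshold (s.reg 2 / 2) (Malleable.numTasks (s.reg 2) s.mem)
      (Malleable.numMachines (s.reg 2) s.mem) (Malleable.boundAt (s.reg 2) s.mem)
      (Malleable.deadlineAt late (s.reg 2) s.mem) (Malleable.restAt (s.reg 2) s.mem (u s))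
      (Malleable.lengthAt late (s.reg 2) s.mem (u s)) :=
  srch (bits hu.three_le).half (fun _ => Nat.div_le_self _ _) fun _ he _ hx =>
    (((hu.mono he).machineTime late).add (const hx.three_le 1)).sub ((hu.mono he).urgentSum late hx)

theorem shareAt (late : Bool) (hu : Computes d u) (hv : Computes d v) :
    Computes d fun s => shareAt late (s.reg 2) s.mem (u s) (v s) := by
  have hd := hu.three_le
  have hv' := hv.min (bits hd)
  have hσ := hu.threshold late
  have step : ∀ e, d ≤ e → ∀ x, Computes e x → Computes e fun s =>
      urgentStep (Malleable.boundAt (s.reg 2) s.mem)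
      (Malleable.deadlineAt late (s.reg 2) s.mem) (Malleable.restAt (s.reg 2) s.mem (u s))
      (Malleable.lengthAt late (s.reg 2) s.mem (u s)) (Malleable.threshold (s.reg 2 / 2)
      (Malleable.numTasks (s.reg 2) s.mem)
      (Malleable.numMachines (s.reg 2) s.mem) (Malleable.boundAt (s.reg 2) s.mem)
      (Malleable.deadlineAt late (s.reg 2) s.mem) (Malleable.restAt (s.reg 2) s.mem (u s))
      (Malleable.lengthAt late (s.reg 2) s.mem (u s))) (x s) := fun e he x hx =>
    ((hu.mono he).urgent late hx ((hσ.mono he).add (const hx.three_le 1))).sub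
      ((hu.mono he).urgent late hx (hσ.mono he))
  exact (hu.urgent late hv' hσ).add ((step d le_rfl _ hv').min
    (((hu.machineTime late).sub (hu.urgentSum late hσ)).sub
      (sum_of_le hv' (fun _ => min_le_right _ _) step)))

theorem shareCell (late : Bool) (hu : Computes d u) :
    Computes d fun s => shareCell late (s.reg 2) s.mem (u s) := by
  have hlt : ∀ s : State, u s % 2 ^ s.reg 2 < 2 ^ s.reg 2 := fun s =>
    Nat.mod_lt _ (Nat.two_pow_pos _)
  exact (hu.mod_two_pow.div_of_lt (bits hu.three_le) hlt).shareAt late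
    (hu.mod_two_pow.mod_of_lt (bits hu.three_le) hlt)

theorem positionAt (hu : Computes d u) (hv : Computes d v) :
    Computes d fun s => positionAt (s.reg 2) s.mem (u s) (v s) :=
  (sum hv fun _ he _ hx => (hu.mono he).shareLoad hx).mod_two_pow

theorem positionAt_lt (K : ℕ) (m : ℕ → ℕ) (p i : ℕ) : Malleable.positionAt K m p i < 2 ^ K :=
  Nat.mod_lt _ (Nat.two_pow_pos _)

theorem column (hf : Computes d f) (hP : Computes d P) (hu : Computes d u)
    (hlt : ∀ s, P s < 2 ^ s.reg 2) : Computes d fun s => column (f s) (P s) (u s) :=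
  (hP.div_of_lt hf hlt).add (hu.ite_lt (hP.mod_of_lt hf hlt) (const hu.three_le 1)
    (const hu.three_le 0))

theorem splitAt (hf : Computes d f) (hP : Computes d P) (hP' : Computes d P') (hu : Computes d u)
    (hlt : ∀ s, P s < 2 ^ s.reg 2) (hlt' : ∀ s, P' s < 2 ^ s.reg 2) :
    Computes d fun s => splitAt (f s) (P s) (P' s) (u s) := by
  have hd := hf.three_le
  have h1 := hP.mod_of_lt hf hlt
  have h2 := hP'.mod_of_lt hf hlt'
  exact hu.ite_eq (const hd 0) (const hd 0) (hu.ite_eq (const hd 1) (h1.min h2)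
    (hu.ite_eq (const hd 2) (h1.max h2) hf))

theorem blockCell (late : Bool) (hu : Computes d u) :
    Computes d fun s => blockCell late (s.reg 2) s.mem (u s) := by
  have hd := hu.three_le
  have hlt : ∀ s : State, u s % 2 ^ s.reg 2 < 2 ^ s.reg 2 := fun s =>
    Nat.mod_lt _ (Nat.two_pow_pos _)
  have hlt' : ∀ (a : ℕ) (s : State), u s % 2 ^ s.reg 2 / a < 2 ^ s.reg 2 := fun a s =>
    (Nat.div_le_self _ _).trans_lt (hlt s)
  have hq := hu.mod_two_pow
  have hp := (hq.div_of_lt (const hd 12) hlt).div_of_lt (bits hd) (hlt' 12)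
  have hi := (hq.div_of_lt (const hd 12) hlt).mod_of_lt (bits hd) (hlt' 12)
  have hb := (hq.div_of_lt (const hd 4) hlt).mod_of_lt (const hd 3) (hlt' 4)
  have hf := hq.mod_of_lt (const hd 4) hlt
  have hl := hp.lengthAt late
  have hτ := hp.startAt late
  have hP := hp.positionAt hi
  have hP' := hp.positionAt (hi.add (const hd 1))
  have hs := fun {x : State → ℕ} (hx : Computes d x) => hl.splitAt hP hP' hx
    (fun s => positionAt_lt _ _ _ _) (fun s => positionAt_lt _ _ _ _)
  refine hf.ite_eq (const hd 0) hi (hf.ite_eq (const hd 1) ((hτ.add (hs hb)).add (const hd 1))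
    (hf.ite_eq (const hd 2) (hτ.add (hs (hb.add (const hd 1)))) ?_))
  exact hp.ite_lt (numTasks hd) (hi.ite_lt (numTasks hd) ((const hd 0).ite_lt hl
    ((hl.column hP' (hs hb) fun s => positionAt_lt _ _ _ _).sub
      (hl.column hP (hs hb) fun s => positionAt_lt _ _ _ _)) (const hd 0)) (const hd 0)) (const hd 0)

end Computes

theorem sum_range_mul (f : ℕ → ℕ) (a c : ℕ) :
    ∑ x ∈ range (c * a), f x = ∑ u ∈ range c, ∑ v ∈ range a, f (u * a + v) := by
  induction c with
  | zero => simp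
  | succ c ih => rw [Nat.succ_mul, sum_range_add, ih, sum_range_succ]

/-! ### The input -/

theorem bitSize_eq (l : List ℕ) :
    bitSize l = ∑ a ∈ range l.length, (Nat.size (l.getD a 0) + 1) := by
  induction l with
  | nil => rfl
  | cons x l ih =>
    rw [List.length_cons, sum_range_succ', add_comm]
    simp only [List.getD_cons_succ, List.getD_cons_zero, ← ih]
    rfl

theorem getD_flatMap {α : Type*} (f : α → List ℕ) (c : ℕ) (hf : ∀ x, (f x).length = c)
    (L : List α) (i : ℕ) (hi : i < L.length) (r : ℕ) (hr : r < c) :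
    (L.flatMap f).getD (c * i + r) 0 = (f L[i]).getD r 0 := by
  induction L generalizing i with
  | nil => simp at hi
  | cons x L ih =>
    rw [List.flatMap_cons]
    cases i with
    | zero => rw [List.getD_append _ _ _ _ (by rw [hf]; omega)]; simp
    | succ i =>
      rw [List.getD_append_right _ _ _ _ (by rw [hf, mul_add]; omega), hf,
        show c * (i + 1) + r - c = c * i + r by rw [mul_add]; omega]
      exact ih i (by simpa using hi)

section Input

variable (I : Instance) (ε : ℚ≥0)

theorem length_encode : (encode I ε).length = 4 + 5 * I.n := by
  simp [encode, List.length_flatMap, mul_comm]; omega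

theorem mem_task (i : Fin I.n) (r : ℕ) (hr : r < 5) :
    (initState (encode I ε)).mem (4 + 5 * i + r) =
      [I.demand i, I.bound i, (I.weight i).num, (I.weight i).den, I.due i].getD r 0 := by
  change (encode I ε).getD (4 + 5 * i + r) 0 = _
  rw [encode, List.getD_append_right _ _ _ _ (by simp; omega)]
  rw [show 4 + 5 * (i : ℕ) + r - [I.n, I.C, ε.num, ε.den].length = 5 * i + r by simp; omega,
    getD_flatMap _ 5 (fun _ => rfl) _ _ (by simp) _ hr]
  simp

theorem bitSize_encode : bitSize (encode I ε) =
    ∑ a ∈ range (4 + 5 * I.n), (Nat.size ((initState (encode I ε)).mem a) + 1) := by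
  rw [bitSize_eq, length_encode]
  rfl

end Input

/-! ### Measuring the input -/

theorem size_half {v : ℕ} (hv : v ≠ 0) : Nat.size v = Nat.size (v / 2) + 1 := by
  have h : ∀ k, Nat.size v ≤ k + 1 ↔ Nat.size (v / 2) ≤ k := fun k => by
    rw [Nat.size_le, Nat.size_le, pow_succ]; omega
  have h0 : 0 < Nat.size v := Nat.size_pos.2 (by omega)
  have h1 := (h (Nat.size v - 1)).1 (by omega)
  have h2 := (h (Nat.size (v / 2))).2 le_rfl
  omega

/-- Halving `v` down to `0` takes `Nat.size v` rounds, each of which adds register `7` to the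
measured size. -/
theorem exec_halve (v : ℕ) : ∀ s : State, s.reg 6 = v →
    ∃ t s', Exec (.loop 6 (.seq (.half 6 6) (.add 2 2 7))) s t s' ∧ t ≤ 3 * Nat.size v + 1 ∧
      s'.mem = s.mem ∧ s'.reg 2 = s.reg 2 + Nat.size v * s.reg 7 ∧
      ∀ r, r ≠ 2 → r ≠ 6 → s'.reg r = s.reg r := by
  induction v using Nat.strong_induction_on with
  | _ v ih =>
    intro s hs
    rcases Nat.eq_zero_or_pos v with h0 | h0
    · subst h0
      exact ⟨1, s, .loop_done hs, by simp, rfl, by simp, fun _ _ _ => rfl⟩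
    · obtain ⟨t, s', h1, h2, h3, h4, h5⟩ := ih (v / 2) (by omega)
        ((s.setReg 6 (s.reg 6 / 2)).setReg 2 ((s.setReg 6 (s.reg 6 / 2)).reg 2 +
          (s.setReg 6 (s.reg 6 / 2)).reg 7)) (by simp [State.setReg, hs])
      have hsz := size_half (show v ≠ 0 by omega)
      refine ⟨_, s', .loop_step (by omega) (.seq (.half _ _ _) (.add _ _ _ _)) h1, by omega,
        by simpa using h3, ?_, fun r hr hr' => ?_⟩
      · rw [h4, hsz]; simp [State.setReg]; ring
      · rw [h5 r hr hr']; simp [State.setReg, hr, hr']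

/-- The program that computes `16` times the size of the input in register `2`. -/
def measure : Prog :=
  .seq (.const 3 1) (.seq (.const 7 16) (.seq (.load 5 5) (.seq (.add 4 5 5) (.seq (.add 4 4 4)
    (.seq (.add 4 4 5) (.seq (.const 5 4) (.seq (.add 4 4 5) (.seq (.const 5 0)
      (.loop 4 (.seq (.load 6 5) (.seq (.add 2 2 7) (.seq
        (.loop 6 (.seq (.half 6 6) (.add 2 2 7))) (.seq (.add 5 5 3) (.sub 4 4 3))))))))))))))

theorem exec_measure (m : ℕ → ℕ) : ∃ t s', Exec measure ⟨fun _ => 0, m⟩ t s' ∧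
    t ≤ (4 + 5 * m 0) * (3 * ∑ a ∈ range (4 + 5 * m 0), (Nat.size (m a) + 1) + 6) + 10 ∧
    s'.mem = m ∧ s'.reg 2 = 16 * ∑ a ∈ range (4 + 5 * m 0), (Nat.size (m a) + 1) := by
  set N := 4 + 5 * m 0 with hN
  set S := ∑ a ∈ range N, (Nat.size (m a) + 1) with hS
  obtain ⟨t, s', h1, h2, -, h4, h5⟩ := exec_loop (P := .seq (.load 6 5) (.seq (.add 2 2 7) (.seq
        (.loop 6 (.seq (.half 6 6) (.add 2 2 7))) (.seq (.add 5 5 3) (.sub 4 4 3))))) (a := 4)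
      (N := 3 * S + 5) (fun j s => j ≤ N ∧ s.mem = m ∧
        s.reg 2 = 16 * ∑ a ∈ range (N - j), (Nat.size (m a) + 1) ∧ s.reg 3 = 1 ∧ s.reg 5 = N - j ∧
        s.reg 7 = 16) (by
    rintro j s hj ⟨hjN, hm, hr2, hr3, hr5, hr7⟩
    obtain ⟨t, s', h1, h2, h3, h4, h5⟩ := exec_halve (m (N - (j + 1)))
      ((s.setReg 6 (s.mem (s.reg 5))).setReg 2 ((s.setReg 6 (s.mem (s.reg 5))).reg 2 +
          (s.setReg 6 (s.mem (s.reg 5))).reg 7)) (by simp [State.setReg, hm, hr5])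
    have e3 := h5 3 (by omega) (by omega)
    have e4 := h5 4 (by omega) (by omega)
    have e5 := h5 5 (by omega) (by omega)
    have e7 := h5 7 (by omega) (by omega)
    simp [State.setReg] at e3 e4 e5 e7 h3 h4
    have hle : Nat.size (m (N - (j + 1))) + 1 ≤ S :=
      single_le_sum (f := fun a => Nat.size (m a) + 1) (fun _ _ => Nat.zero_le _)
        (mem_range.2 (by omega))
    refine ⟨_, _, .seq (.load _ _ _) (.seq (.add _ _ _ _) (.seq h1 (.seq (.add _ _ _ _)
      (.sub _ _ _ _)))), by omega, ?_, by omega, ?_, ?_, ?_, ?_, ?_⟩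
    · simp [State.setReg, e3, e4, hj, hr3]
    · simp [h3, hm]
    · rw [show N - j = N - (j + 1) + 1 by omega, sum_range_succ]
      simp [State.setReg, h4, hr2, hr7]
      ring
    · simp [State.setReg, e3, hr3]
    · simp [State.setReg, e3, e5, hr3, hr5]; omega
    · simp [State.setReg, e7, hr7]) N
      (((((((((State.mk (fun _ => 0) m).setReg 3 1).setReg 7 16).setReg 5 (m 0)).setReg 4
        (m 0 + m 0)).setReg 4 (m 0 + m 0 + (m 0 + m 0))).setReg 4
        (m 0 + m 0 + (m 0 + m 0) + m 0)).setReg 5 4).setReg 4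
        (m 0 + m 0 + (m 0 + m 0) + m 0 + 4) |>.setReg 5 0) (by simp [State.setReg]; omega)
      ⟨le_rfl, by simp [State.setReg], by simp [State.setReg], by simp [State.setReg],
        by simp [State.setReg], by simp [State.setReg]⟩
  refine ⟨_, s', .seq (.const _ _ _) (.seq (.const _ _ _) (.seq (.load _ _ _) (.seq (.add _ _ _ _)
    (.seq (.add _ _ _ _) (.seq (.add _ _ _ _) (.seq (.const _ _ _) (.seq (.add _ _ _ _)
      (.seq (.const _ _ _) h1)))))))), ?_, h4, by simpa using h5.1⟩
  have : N * (3 * S + 5 + 1) = N * (3 * S + 6) := rfl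
  omega

/-! ### The tables in the memory -/

section SameInput

variable {late : Bool} {K : ℕ} {m m' : ℕ → ℕ}

theorem numTasks_congr (hK : 0 < K) (h : ∀ a < K, m' a = m a) : numTasks K m' = numTasks K m := by
  rw [numTasks, numTasks, h 0 hK]

/-- The data read only cells below `K`. The tables are written above, so the data do not change
while they are filled. -/
theorem data_congr (hn : 4 + 5 * numTasks K m ≤ K) (h : ∀ a < K, m' a = m a) :
    numMachines K m' = numMachines K m ∧ demandAt K m' = demandAt K m ∧
      boundAt K m' = boundAt K m ∧ deadlineAt late K m' = deadlineAt late K m := by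
  have h0 := numTasks_congr (by omega) h
  have h1 : numMachines K m' = numMachines K m := by rw [numMachines, numMachines, h 1 (by omega)]
  have h2 : demandAt K m' = demandAt K m := by
    funext i
    simp only [demandAt, h0]
    split_ifs with hi
    · exact h _ (by omega)
    · rfl
  have h3 : boundAt K m' = boundAt K m := by
    funext i
    simp only [boundAt, h0]
    split_ifs with hi
    · rw [h _ (by omega)]
    · rfl
  have h4 : weightAt K m' = weightAt K m := by
    funext i
    simp only [weightAt, h0]
    split_ifs with hi
    · refine prod_congr rfl fun j hj => ?_
      have := mem_range.1 hj
      rw [h (4 + 5 * i + 2) (by omega), h (4 + 5 * j + 3) (by omega)]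
    · rfl
  have h5 : ∀ i < numTasks K m, dueAt late K m' i = dueAt late K m i := by
    intro i hi
    simp only [dueAt, h (4 + 5 * i + 4) (by omega)]
  have h6 : dueSum late K m' = dueSum late K m := by
    simp only [dueSum, h0, h4]
    exact sum_congr rfl fun i hi => by rw [h5 i (mem_range.1 hi)]
  have h7 : offsetAt late K m' = offsetAt late K m := by
    funext i
    simp only [offsetAt, h0, h4, h6]
    split_ifs with hi
    · rw [h5 i hi]
    · rfl
  refine ⟨h1, h2, h3, ?_⟩
  funext i
  simp only [deadlineAt, valueOf, h0, h1, h2, h3, h4, h7]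

theorem startAt_congr (hn : 4 + 5 * numTasks K m ≤ K) (h : ∀ a < K, m' a = m a) :
    startAt late K m' = startAt late K m := by
  funext p
  rw [startAt, startAt, numTasks_congr (by omega) h, (data_congr hn h).2.2.2]

theorem lengthAt_congr (hn : 4 + 5 * numTasks K m ≤ K) (h : ∀ a < K, m' a = m a) :
    lengthAt late K m' = lengthAt late K m := by
  funext p
  rw [lengthAt, lengthAt, startAt_congr hn h]

end SameInput

/-- The work of task `i` in segment `p`. -/
def shareOf (late : Bool) (K : ℕ) (m : ℕ → ℕ) (p i : ℕ) : ℕ :=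
  share (K / 2) (numTasks K m) (numMachines K m) (boundAt K m) (deadlineAt late K m)
    (demandAt K m) p i

section Tables

variable {late : Bool} {K : ℕ} {m : ℕ → ℕ}

theorem startAt_eq {p : ℕ} (hp : p ≤ K) :
    startAt late K m p = segStart (K / 2) (numTasks K m) (deadlineAt late K m) p := by
  rw [startAt, min_eq_left hp]

theorem shareAt_eq {m' : ℕ → ℕ} (hn : 4 + 5 * numTasks K m ≤ K) (h : ∀ a < K, m' a = m a)
    {p i : ℕ} (hp : p < K) (hi : i < K)
    (hs : ∀ q < p, ∀ j < numTasks K m, m' (K + q * K + j) = shareOf late K m q j) :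
    shareAt late K m' p i = shareOf late K m p i := by
  have h1 : restAt K m' p = rest (K / 2) (numTasks K m) (numMachines K m) (boundAt K m)
      (deadlineAt late K m) (demandAt K m) p := by
    funext j
    rw [rest_eq, restAt, numTasks_congr (by omega) h, (data_congr (late := late) hn h).2.1]
    split_ifs with hj
    · rw [min_eq_left hp.le]
      congr 1
      exact sum_congr rfl fun q hq => hs q (mem_range.1 hq) j hj
    · simp [demandAt, hj]
  obtain ⟨h2, h3, h4, h5⟩ := data_congr (late := late) hn h
  rw [shareAt, h1, h2, h4, h5, lengthAt_congr hn h, numTasks_congr (by omega) h,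
    min_eq_left hi.le, lengthAt, startAt_eq hp, startAt_eq hp.le]
  rfl

/-- The table is filled row by row. When row `p` is computed, all earlier segments are complete, and
these are all that the remaining work depends on. -/
theorem fillMem_share (hn : 4 + 5 * numTasks K m ≤ K) (hK : 12 * (K * K) < 2 ^ K)
    {p i : ℕ} (hp : p < K) (hi : i < numTasks K m) :
    fillMem (shareCell late K) K m (K * K) (K + p * K + i) = shareOf late K m p i := by
  induction p using Nat.strong_induction_on generalizing i with
  | _ p ih =>
    have hq : ∀ p' < K, ∀ i' < K, p' * K + i' < K * K := fun p' hp' i' hi' => by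
      have := Nat.mul_le_mul_right K (show p' + 1 ≤ K by omega)
      rw [Nat.succ_mul] at this
      omega
    have hlt := hq p hp i (by omega)
    rw [add_assoc, fillMem_apply hlt, shareCell, Nat.mod_eq_of_lt (by omega),
      show (p * K + i) / K = p by
        rw [mul_comm, Nat.mul_add_div (by omega), Nat.div_eq_of_lt (by omega), add_zero],
      show (p * K + i) % K = i by
        rw [mul_comm, Nat.mul_add_mod, Nat.mod_eq_of_lt (by omega)]]
    refine shareAt_eq hn (fun a ha => fillMem_of_lt ha _) hp (by omega) fun q hqp j hj => ?_
    rw [← ih q hqp (by omega) hj]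
    refine (fillMem_stable ?_ hlt.le).symm
    have := Nat.mul_le_mul_right K (show q + 1 ≤ p by omega)
    rw [Nat.succ_mul] at this
    omega

/-- As functions of the column, the two counts jump only at `P % l` and `P' % l`. They are constant
on the three pieces between these cuts, some of which may be empty. -/
theorem blocks_cover {l : ℕ} (hl : 0 < l) (τ P P' t : ℕ) :
    (∑ b ∈ range 3, if τ + splitAt l P P' b + 1 ≤ t ∧ t ≤ τ + splitAt l P P' (b + 1) then
      column l P' (splitAt l P P' b) - column l P (splitAt l P P' b) else 0) =
    if τ < t ∧ t ≤ τ + l then column l P' (t - 1 - τ) - column l P (t - 1 - τ) else 0 := by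
  have h1 := Nat.mod_lt P hl
  have h2 := Nat.mod_lt P' hl
  simp only [sum_range_succ, sum_range_zero, splitAt, column, zero_add]
  norm_num
  generalize P % l = r at *
  generalize P' % l = r' at *
  generalize P / l = a at *
  generalize P' / l = a' at *
  rcases le_total r r' with h | h
  · rw [min_eq_left h, max_eq_right h]
    split_ifs <;> omega
  · rw [min_eq_right h, max_eq_left h]
    split_ifs <;> omega

end Tables

/-- The memory after the work of all tasks in all segments has been computed. -/
def shareMem (late : Bool) (K : ℕ) (m : ℕ → ℕ) : ℕ → ℕ :=
  fillMem (shareCell late K) K m (K * K)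

/-- The memory after the blocks have been computed. -/
def blockMem (late : Bool) (K : ℕ) (m : ℕ → ℕ) : ℕ → ℕ :=
  fillMem (blockCell late K) (K + K * K) (shareMem late K m) (12 * (K * K))

section Blocks

variable {late : Bool} {K : ℕ} {m : ℕ → ℕ}

theorem grid_lt {p i : ℕ} (hp : p < K) (hi : i < K) : p * K + i < K * K := by
  have := Nat.mul_le_mul_right K (show p + 1 ≤ K by omega)
  rw [Nat.succ_mul] at this
  omega

theorem blockMem_entry (hn : 4 + 5 * numTasks K m ≤ K) (hK : 12 * (K * K) < 2 ^ K)
    {p i b f : ℕ} (hp : p < K) (hi : i < K) (hb : b < 3) (hf : f < 4) :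
    blockMem late K m (K + K * K + 4 * ((p * K + i) * 3 + b) + f) =
      blockEntry (numTasks K m) (lengthAt late K m p) (startAt late K m p)
        (positionAt K (shareMem late K m) p i) (positionAt K (shareMem late K m) p (i + 1))
        p i b f := by
  have hlt := grid_lt hp hi
  have hq : 4 * ((p * K + i) * 3 + b) + f < 12 * (K * K) := by omega
  rw [blockMem, add_assoc, fillMem_apply hq]
  generalize hM : fillMem (blockCell late K) (K + K * K) (shareMem late K m)
    (4 * ((p * K + i) * 3 + b) + f) = M
  have hM1 : ∀ a < K + K * K, M a = shareMem late K m a := fun a ha => by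
    rw [← hM]; exact fillMem_of_lt ha _
  have hM0 : ∀ a < K, M a = m a := fun a ha => by
    rw [hM1 a (by omega)]; exact fillMem_of_lt ha _
  have hpos : ∀ j, positionAt K M p j = positionAt K (shareMem late K m) p j := fun j => by
    rw [positionAt, positionAt]
    congr 1
    refine sum_congr rfl fun x hx => hM1 _ ?_
    have := mem_range.1 hx
    have := grid_lt hp (show x < K by omega)
    omega
  rw [blockCell, Nat.mod_eq_of_lt (by omega),
    show (4 * ((p * K + i) * 3 + b) + f) / 12 = p * K + i by omega,
    show (4 * ((p * K + i) * 3 + b) + f) / 4 % 3 = b by omega,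
    show (4 * ((p * K + i) * 3 + b) + f) % 4 = f by omega,
    show (p * K + i) / K = p by
      rw [mul_comm, Nat.mul_add_div (by omega), Nat.div_eq_of_lt hi, add_zero],
    show (p * K + i) % K = i by rw [mul_comm, Nat.mul_add_mod, Nat.mod_eq_of_lt hi],
    numTasks_congr (by omega) hM0, lengthAt_congr hn hM0, startAt_congr hn hM0, hpos, hpos]

/-- The shares of a segment fit into `C * l` with `l < 2 ^ (K / 2)`, so positions are not affected
by truncation. -/
theorem sum_shareOf_lt (hC : numMachines K m * 2 ^ (K / 2) < 2 ^ K)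
    (hH : Hall (numTasks K m) (numMachines K m) (boundAt K m) (deadlineAt late K m)
      (demandAt K m) 0) (p : ℕ) :
    ∑ i ∈ range (numTasks K m), shareOf late K m p i < 2 ^ K := by
  refine lt_of_le_of_lt ?_ hC
  refine ((sum_allot (hall_rest hH (fun i _ => deadline_lt i) p)).le.trans (min_le_left _ _)).trans ?_
  exact Nat.mul_le_mul_left _ ((Nat.sub_le _ _).trans (segStart_lt _).le)

theorem positionAt_eq (hn : 4 + 5 * numTasks K m ≤ K) (hK : 12 * (K * K) < 2 ^ K)
    (hC : numMachines K m * 2 ^ (K / 2) < 2 ^ K)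
    (hH : Hall (numTasks K m) (numMachines K m) (boundAt K m) (deadlineAt late K m)
      (demandAt K m) 0) {p i : ℕ} (hp : p < K) (hi : i ≤ numTasks K m) :
    positionAt K (shareMem late K m) p i = ∑ j ∈ range i, shareOf late K m p j := by
  have h1 : ∑ j ∈ range i, shareMem late K m (K + p * K + j) =
      ∑ j ∈ range i, shareOf late K m p j :=
    sum_congr rfl fun j hj => fillMem_share hn hK hp ((mem_range.1 hj).trans_le hi)
  rw [positionAt, min_eq_left (by omega), h1, Nat.mod_eq_of_lt]
  exact (sum_le_sum_of_subset (range_mono hi)).trans_lt (sum_shareOf_lt hC hH p)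

/-- The table has `K * K` pairs. Rows beyond the number of segments carry zero machines, and other
tasks fail the comparison with `i`, so only the three blocks of task `i` in each real segment
remain. -/
theorem sum_blocks (hn : 4 + 5 * numTasks K m ≤ K) (hK : 12 * (K * K) < 2 ^ K)
    (hC : numMachines K m * 2 ^ (K / 2) < 2 ^ K)
    (hH : Hall (numTasks K m) (numMachines K m) (boundAt K m) (deadlineAt late K m)
      (demandAt K m) 0) {i : ℕ} (hi : i < numTasks K m) (t : ℕ) :
    (∑ j ∈ range (K * K * 3), if blockMem late K m (K + K * K + 4 * j) = i ∧
        blockMem late K m (K + K * K + 4 * j + 1) ≤ t ∧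
        t ≤ blockMem late K m (K + K * K + 4 * j + 2)
      then blockMem late K m (K + K * K + 4 * j + 3) else 0) =
      machines (K / 2) (numTasks K m) (numMachines K m) (boundAt K m) (deadlineAt late K m)
        (demandAt K m) i t := by
  have hiK : i < K := by omega
  rw [sum_range_mul, sum_range_mul, machines,
    ← sum_subset (range_mono (show numTasks K m ≤ K by omega))]
  · refine sum_congr rfl fun p hp => ?_
    have hp := mem_range.1 hp
    have hpK : p < K := by omega
    rw [sum_eq_single_of_mem i (mem_range.2 hiK)]
    · have e : ∀ b ∈ range 3, (if blockMem late K m (K + K * K + 4 * ((p * K + i) * 3 + b)) = i ∧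
          blockMem late K m (K + K * K + 4 * ((p * K + i) * 3 + b) + 1) ≤ t ∧
          t ≤ blockMem late K m (K + K * K + 4 * ((p * K + i) * 3 + b) + 2)
          then blockMem late K m (K + K * K + 4 * ((p * K + i) * 3 + b) + 3) else 0) =
          if startAt late K m p + splitAt (lengthAt late K m p) (∑ j ∈ range i, shareOf late K m p j)
            (∑ j ∈ range (i + 1), shareOf late K m p j) b + 1 ≤ t ∧ t ≤ startAt late K m p +
            splitAt (lengthAt late K m p) (∑ j ∈ range i, shareOf late K m p j)
            (∑ j ∈ range (i + 1), shareOf late K m p j) (b + 1) then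
            if 0 < lengthAt late K m p then
              column (lengthAt late K m p) (∑ j ∈ range (i + 1), shareOf late K m p j)
                (splitAt (lengthAt late K m p) (∑ j ∈ range i, shareOf late K m p j)
                (∑ j ∈ range (i + 1), shareOf late K m p j) b) -
              column (lengthAt late K m p) (∑ j ∈ range i, shareOf late K m p j)
                (splitAt (lengthAt late K m p) (∑ j ∈ range i, shareOf late K m p j)
                (∑ j ∈ range (i + 1), shareOf late K m p j) b) else 0 else 0 := by
        intro b hb
        have hb := mem_range.1 hb
        have h0 := blockMem_entry (late := late) hn hK hpK hiK hb (show 0 < 4 by omega)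
        have h1 := blockMem_entry (late := late) hn hK hpK hiK hb (show 1 < 4 by omega)
        have h2 := blockMem_entry (late := late) hn hK hpK hiK hb (show 2 < 4 by omega)
        have h3 := blockMem_entry (late := late) hn hK hpK hiK hb (show 3 < 4 by omega)
        rw [add_zero] at h0
        rw [h0, h1, h2, h3, positionAt_eq hn hK hC hH hpK hi.le, positionAt_eq hn hK hC hH hpK hi]
        simp [blockEntry, hp, hi]
      rw [sum_congr rfl e]
      have hst := startAt_eq (late := late) (m := m) hpK.le
      have hst' := startAt_eq (late := late) (m := m) (show p + 1 ≤ K by omega)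
      have hmono := segStart_mono (n := numTasks K m) (d := deadlineAt late K m) (G := K / 2)
        (fun i _ => deadline_lt i) (Nat.le_succ p)
      rw [Nat.succ_eq_add_one, ← hst, ← hst'] at hmono
      rw [← hst, ← hst']
      have hl : startAt late K m (p + 1) = startAt late K m p + lengthAt late K m p := by
        unfold lengthAt; omega
      rcases Nat.eq_zero_or_pos (lengthAt late K m p) with h0 | h0
      · rw [h0] at hl
        rw [if_neg (by omega)]
        exact sum_eq_zero fun b _ => by rw [h0]; simp
      · simp only [if_pos h0]
        rw [blocks_cover h0, hl, Nat.add_sub_cancel_left]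
        rfl
    · intro i' hi' hne
      refine sum_eq_zero fun b hb => if_neg fun h => hne ?_
      have h0 := blockMem_entry (late := late) hn hK hpK (mem_range.1 hi') (mem_range.1 hb)
        (show 0 < 4 by omega)
      rw [add_zero, h.1] at h0
      exact h0.symm
  · intro p hp hp'
    rw [mem_range] at hp hp'
    refine sum_eq_zero fun i' hi' => sum_eq_zero fun b hb => ?_
    have h3 := blockMem_entry (late := late) hn hK hp (mem_range.1 hi') (mem_range.1 hb)
      (show 3 < 4 by omega)
    rw [h3]
    simp [blockEntry, hp']

end Blocks

/-! ### The program -/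

theorem exists_prog (late : Bool) : ∃ (P : Prog) (q : Polynomial ℕ), ∀ m : ℕ → ℕ,
    ∃ t s, Exec P ⟨fun _ => 0, m⟩ t s ∧
      t ≤ q.eval (∑ a ∈ range (4 + 5 * m 0), (Nat.size (m a) + 1)) ∧
      s.reg 0 = 16 * (∑ a ∈ range (4 + 5 * m 0), (Nat.size (m a) + 1)) *
        (16 * (∑ a ∈ range (4 + 5 * m 0), (Nat.size (m a) + 1))) * 3 ∧
      s.reg 1 = 16 * (∑ a ∈ range (4 + 5 * m 0), (Nat.size (m a) + 1)) +
        16 * (∑ a ∈ range (4 + 5 * m 0), (Nat.size (m a) + 1)) *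
        (16 * (∑ a ∈ range (4 + 5 * m 0), (Nat.size (m a) + 1))) ∧
      s.mem = blockMem late (16 * (∑ a ∈ range (4 + 5 * m 0), (Nat.size (m a) + 1))) m := by
  have hb := Computes.bits (d := 3) le_rfl
  have hsq : Computes 3 fun s => s.reg 2 * s.reg 2 :=
    hb.mul_of_lt hb fun s => Nat.lt_two_pow_self
  have hcount : Computes 3 fun s => s.reg 2 * s.reg 2 * 3 :=
    ((hsq.add hsq).add hsq).of_eq fun s => by ring
  have h12 : Computes 3 fun s => 12 * (s.reg 2 * s.reg 2) :=
    (((hcount.add hcount).add hcount).add hcount).of_eq fun s => by ring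
  obtain ⟨P₁, q₁, h₁⟩ := exec_fill (E := shareCell late) hb hsq (Polynomial.X * Polynomial.X)
    (fun s => by simp) fun e he u hu => hu.shareCell late
  obtain ⟨P₂, q₂, h₂⟩ := exec_fill (E := blockCell late) (hb.add hsq) h12
    (12 * (Polynomial.X * Polynomial.X)) (fun s => by simp) fun e he u hu => hu.blockCell late
  obtain ⟨P₃, q₃, h₃⟩ := hcount.exec 3 le_rfl
  obtain ⟨P₄, q₄, h₄⟩ := (hb.add hsq).exec 4 (by omega)
  refine ⟨.seq measure (.seq P₁ (.seq P₂ (.seq P₃ (.seq P₄ (.seq (.const 5 0)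
    (.seq (.add 0 3 5) (.add 1 4 5))))))),
    -- The first summand pays for measuring the input; the other bounds are polynomials in `K`,
    -- hence the composition with `16 * X`.
    (Polynomial.X * (3 * Polynomial.X + 6) + 10) +
      (q₁ + q₂ + q₃ + q₄ + 3).comp (16 * Polynomial.X), fun m => ?_⟩
  obtain ⟨t₀, s₀, a1, a2, a3, a4⟩ := exec_measure m
  have hN : 4 + 5 * m 0 ≤ ∑ a ∈ range (4 + 5 * m 0), (Nat.size (m a) + 1) := by
    conv_lhs => rw [← card_range (4 + 5 * m 0), card_eq_sum_ones]
    exact sum_le_sum fun _ _ => Nat.le_add_left _ _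
  generalize ∑ a ∈ range (4 + 5 * m 0), (Nat.size (m a) + 1) = S at *
  obtain ⟨t₁, s₁, b1, b2, b3, b4⟩ := h₁ s₀
  have k1 : s₁.reg 2 = 16 * S := by rw [b3 2 (by omega), a4]
  obtain ⟨t₂, s₂, c1, c2, c3, c4⟩ := h₂ s₁
  have k2 : s₂.reg 2 = 16 * S := by rw [c3 2 (by omega), k1]
  obtain ⟨t₃, s₃, d1, d2, d3, d4⟩ := h₃ s₂
  have k3 : s₃.reg 2 = 16 * S := by rw [d4.1 2 (by omega), k2]
  obtain ⟨t₄, s₄, e1, e2, e3, e4⟩ := h₄ s₃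
  rw [a4] at b2 b4
  rw [k1] at c2 c4
  rw [k2] at d2 d3
  rw [k3] at e2 e3
  refine ⟨_, _, .seq a1 (.seq b1 (.seq c1 (.seq d1 (.seq e1 (.seq (.const _ _ _)
    (.seq (.add _ _ _ _) (.add _ _ _ _))))))), ?_, ?_, ?_, ?_⟩
  · have := Nat.mul_le_mul_right (3 * S + 6) hN
    simp
    omega
  · have := e4.1 3 (by omega)
    simp [State.setReg, this, d3]
  · simp [State.setReg, e3]
  · simp [e4.2, d4.2, c4, b4, a3, blockMem, shareMem]

/-! ### Sizes -/

theorem sum_le_two_pow (s : Finset ℕ) (x : ℕ → ℕ) :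
    ∑ i ∈ s, x i ≤ 2 ^ ∑ i ∈ s, (Nat.size (x i) + 1) := by
  induction s using Finset.induction_on with
  | empty => simp
  | insert a s ha ih =>
    rw [sum_insert ha, sum_insert ha, pow_add, pow_succ]
    have h1 := Nat.lt_size_self (x a)
    have h2 := Nat.one_le_two_pow (n := ∑ i ∈ s, (Nat.size (x i) + 1))
    generalize 2 ^ ∑ i ∈ s, (Nat.size (x i) + 1) = b at *
    generalize 2 ^ Nat.size (x a) = c at *
    have h3 : c ≤ c * b := Nat.le_mul_of_pos_right _ h2
    have h4 : b ≤ c * b := Nat.le_mul_of_pos_left _ (by omega)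
    calc _ ≤ c * b + c * b := by omega
      _ = _ := by ring

/-- The size of the input. -/
def inputSize (I : Instance) (ε : ℚ≥0) : ℕ := bitSize (encode I ε)

/-- The memory that contains the input. -/
def inputMem (I : Instance) (ε : ℚ≥0) : ℕ → ℕ := (initState (encode I ε)).mem

/-- The due dates, or `0` if they are to be ignored. -/
def effectiveDue (late : Bool) (I : Instance) (i : Fin I.n) : ℕ := if late then I.due i else 0

section Data

variable (late : Bool) (I : Instance) (ε : ℚ≥0)

theorem inputSize_eq : inputSize I ε =
    ∑ a ∈ range (4 + 5 * I.n), (Nat.size (inputMem I ε a) + 1) := bitSize_encode I ε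

theorem length_le_inputSize : 4 + 5 * I.n ≤ inputSize I ε := by
  rw [inputSize_eq]
  conv_lhs => rw [← card_range (4 + 5 * I.n), card_eq_sum_ones]
  exact sum_le_sum fun _ _ => Nat.le_add_left _ _

theorem inputMem_lt {a : ℕ} (ha : a < 4 + 5 * I.n) : inputMem I ε a < 2 ^ inputSize I ε := by
  refine (Nat.lt_size_self _).trans_le (Nat.pow_le_pow_right two_pos ?_)
  rw [inputSize_eq]
  exact (Nat.le_succ _).trans (single_le_sum (f := fun a => Nat.size (inputMem I ε a) + 1)
    (fun _ _ => Nat.zero_le _) (mem_range.2 ha))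

theorem inputMem_mod {a : ℕ} (ha : a < 4 + 5 * I.n) :
    inputMem I ε a % 2 ^ (16 * inputSize I ε) = inputMem I ε a :=
  Nat.mod_eq_of_lt ((inputMem_lt I ε ha).trans_le (Nat.pow_le_pow_right two_pos (by omega)))

theorem sum_tasks_le : ∑ i ∈ range I.n, ∑ r ∈ range 5,
    (Nat.size (inputMem I ε (4 + 5 * i + r)) + 1) ≤ inputSize I ε := by
  rw [inputSize_eq, sum_range_add, mul_comm 5, sum_range_mul]
  refine le_trans (le_of_eq ?_) (Nat.le_add_left _ _)
  exact sum_congr rfl fun i _ => sum_congr rfl fun r _ => by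
    rw [show 4 + 5 * i + r = 4 + (i * 5 + r) by ring]

theorem numTasks_input : numTasks (16 * inputSize I ε) (inputMem I ε) = I.n := by
  have := length_le_inputSize I ε
  exact min_eq_left (show I.n ≤ _ by omega)

theorem numMachines_input : numMachines (16 * inputSize I ε) (inputMem I ε) = I.C :=
  inputMem_mod I ε (by omega)

theorem demandAt_input (i : Fin I.n) :
    demandAt (16 * inputSize I ε) (inputMem I ε) i = I.demand i := by
  rw [demandAt, numTasks_input, if_pos i.2]
  exact mem_task I ε i 0 (by omega)

theorem boundAt_input (i : Fin I.n) :
    boundAt (16 * inputSize I ε) (inputMem I ε) i = I.bound i := by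
  have := i.2
  rw [boundAt, numTasks_input, if_pos i.2, inputMem_mod I ε (by omega)]
  exact mem_task I ε i 1 (by omega)

theorem dueAt_input (i : Fin I.n) :
    dueAt late (16 * inputSize I ε) (inputMem I ε) i = effectiveDue late I i := by
  have := i.2
  cases late
  · rfl
  · simp only [dueAt, effectiveDue, if_true]
    rw [inputMem_mod I ε (by omega)]
    exact mem_task I ε i 4 (by omega)

theorem dueAt_input_lt {i : ℕ} (hi : i < I.n) :
    dueAt late (16 * inputSize I ε) (inputMem I ε) i < 2 ^ inputSize I ε := by
  cases late
  · exact Nat.two_pow_pos _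
  · simp only [dueAt, if_true]
    rw [inputMem_mod I ε (by omega)]
    exact inputMem_lt I ε (by omega)

theorem weightAt_eq_prod {i : ℕ} (hi : i < I.n) :
    weightAt (16 * inputSize I ε) (inputMem I ε) i = ∏ j ∈ range I.n,
      if j = i then inputMem I ε (4 + 5 * i + 2) else inputMem I ε (4 + 5 * j + 3) := by
  rw [weightAt, numTasks_input, if_pos hi]
  refine prod_congr rfl fun j hj => ?_
  have := mem_range.1 hj
  split_ifs <;> exact inputMem_mod I ε (by omega)

/-- Each factor is bounded by `2` to its length, and the product takes one input number per task, so
the lengths add up to at most the input size. -/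
theorem weightAt_le {i : ℕ} (hi : i < I.n) :
    weightAt (16 * inputSize I ε) (inputMem I ε) i ≤ 2 ^ inputSize I ε := by
  rw [weightAt_eq_prod I ε hi]
  refine le_trans ?_ (Nat.pow_le_pow_right two_pos (sum_tasks_le I ε))
  rw [← prod_pow_eq_pow_sum]
  refine prod_le_prod' fun j _ => ?_
  simp only [sum_range_succ, sum_range_zero]
  split_ifs with h
  · subst h
    exact (Nat.lt_size_self _).le.trans (Nat.pow_le_pow_right two_pos (by omega))
  · exact (Nat.lt_size_self _).le.trans (Nat.pow_le_pow_right two_pos (by omega))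

theorem sum_demandAt_le :
    ∑ i ∈ range I.n, demandAt (16 * inputSize I ε) (inputMem I ε) i ≤ 2 ^ inputSize I ε := by
  refine (sum_le_two_pow _ _).trans (Nat.pow_le_pow_right two_pos ?_)
  refine le_trans (sum_le_sum fun i hi => ?_) (sum_tasks_le I ε)
  rw [demandAt, numTasks_input, if_pos (mem_range.1 hi)]
  exact single_le_sum (f := fun r => Nat.size (inputMem I ε (4 + 5 * i + r)) + 1)
    (fun _ _ => Nat.zero_le _) (mem_range.2 (show 0 < 5 by omega))

theorem dueSum_le : dueSum late (16 * inputSize I ε) (inputMem I ε) ≤ 2 ^ inputSize I ε *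
    (2 ^ inputSize I ε * 2 ^ inputSize I ε) := by
  rw [dueSum, numTasks_input]
  refine (sum_le_card_nsmul _ _ (2 ^ inputSize I ε * 2 ^ inputSize I ε) fun i hi => ?_).trans ?_
  · exact Nat.mul_le_mul (weightAt_le I ε (mem_range.1 hi))
      (dueAt_input_lt late I ε (mem_range.1 hi)).le
  · rw [card_range, smul_eq_mul]
    refine Nat.mul_le_mul_right _ ?_
    have := length_le_inputSize I ε
    have := Nat.lt_two_pow_self (n := inputSize I ε)
    omega

/-- The common denominator of the weights. -/
noncomputable def commonDen (I : Instance) : ℝ := ∏ i : Fin I.n, ((I.weight i).den : ℝ)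

theorem commonDen_pos : 0 < commonDen I :=
  prod_pos fun i _ => by exact_mod_cast (I.weight i).den_pos

theorem weightAt_cast (i : Fin I.n) : (weightAt (16 * inputSize I ε) (inputMem I ε) i : ℝ) =
    I.weight i * commonDen I := by
  have h2 : ∀ j : Fin I.n, inputMem I ε (4 + 5 * j + 2) = (I.weight j).num := fun j =>
    mem_task I ε j 2 (by omega)
  have h3 : ∀ j : Fin I.n, inputMem I ε (4 + 5 * j + 3) = (I.weight j).den := fun j =>
    mem_task I ε j 3 (by omega)
  rw [weightAt_eq_prod I ε i.2, prod_range, Nat.cast_prod, commonDen,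
    ← mul_prod_erase _ _ (mem_univ i), ← mul_prod_erase univ (fun i => ((I.weight i).den : ℝ))
      (mem_univ i), if_pos rfl, h2, ← mul_assoc]
  congr 1
  · rw [NNRat.cast_def]
    have : ((I.weight i).den : ℝ) ≠ 0 := by exact_mod_cast (I.weight i).den_pos.ne'
    field_simp
  · refine prod_congr rfl fun j hj => ?_
    rw [if_neg fun h => (mem_erase.1 hj).1 (Fin.ext h), h3]

theorem offsetAt_add (i : Fin I.n) : offsetAt late (16 * inputSize I ε) (inputMem I ε) i +
    weightAt (16 * inputSize I ε) (inputMem I ε) i * effectiveDue late I i =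
      dueSum late (16 * inputSize I ε) (inputMem I ε) := by
  have h1 : weightAt (16 * inputSize I ε) (inputMem I ε) i *
      dueAt late (16 * inputSize I ε) (inputMem I ε) i ≤
      dueSum late (16 * inputSize I ε) (inputMem I ε) := by
    rw [dueSum, numTasks_input]
    exact single_le_sum (f := fun i => weightAt (16 * inputSize I ε) (inputMem I ε) i *
      dueAt late (16 * inputSize I ε) (inputMem I ε) i) (fun _ _ => Nat.zero_le _)
      (mem_range.2 i.2)
  rw [dueAt_input] at h1
  rw [offsetAt, numTasks_input, if_pos i.2, dueAt_input]
  omega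

end Data

/-- The maximum weighted lateness with respect to the effective due dates. -/
noncomputable def effectiveLateness (late : Bool) (I : Instance) (y : Schedule I) : ℝ :=
  ⨆ i, (I.weight i : ℝ) * ((completionTime y i : ℝ) - (effectiveDue late I i : ℝ))

/-! ### Correctness of the computed schedule -/

section Correctness

variable (late : Bool) (I : Instance) (ε : ℚ≥0)

/-- With `X = 2 ^ S` for the input size `S`, machines, total work and weights are at most `X`, and
offsets at most `X ^ 3`. Values therefore fit below `X ^ 4`, times below `X ^ 8`, and positions
below `X ^ 9 ≤ X ^ 16 = 2 ^ K`. -/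
theorem input_bounds :
    4 + 5 * numTasks (16 * inputSize I ε) (inputMem I ε) ≤ 16 * inputSize I ε ∧
    12 * ((16 * inputSize I ε) * (16 * inputSize I ε)) < 2 ^ (16 * inputSize I ε) ∧
    numMachines (16 * inputSize I ε) (inputMem I ε) * 2 ^ (16 * inputSize I ε / 2) <
      2 ^ (16 * inputSize I ε) ∧
    2 ^ (16 * inputSize I ε / 2 / 2) +
      ∑ i ∈ range I.n, demandAt (16 * inputSize I ε) (inputMem I ε) i <
      2 ^ (16 * inputSize I ε / 2) ∧
    ∀ i < I.n, weightAt (16 * inputSize I ε) (inputMem I ε) i *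
      ∑ i ∈ range I.n, demandAt (16 * inputSize I ε) (inputMem I ε) i +
      offsetAt late (16 * inputSize I ε) (inputMem I ε) i ≤ 2 ^ (16 * inputSize I ε / 2 / 2) - 1 := by
  have h1 := length_le_inputSize I ε
  have hC : I.C < 2 ^ inputSize I ε := inputMem_lt I ε (a := 1) (by omega)
  have hD := sum_demandAt_le I ε
  have hM := dueSum_le late I ε
  have hW := fun i (hi : i < I.n) => weightAt_le I ε hi
  have hc : ∀ i < I.n, offsetAt late (16 * inputSize I ε) (inputMem I ε) i ≤
      dueSum late (16 * inputSize I ε) (inputMem I ε) := fun i hi => by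
    have := offsetAt_add late I ε ⟨i, hi⟩
    dsimp only at this
    omega
  have hX : 2 ^ 4 ≤ 2 ^ inputSize I ε := Nat.pow_le_pow_right two_pos (by omega)
  have hS := Nat.lt_two_pow_self (n := inputSize I ε)
  rw [numTasks_input, numMachines_input, show 16 * inputSize I ε / 2 = inputSize I ε * 8 by omega,
    show inputSize I ε * 8 / 2 = inputSize I ε * 4 by omega,
    show 2 ^ (16 * inputSize I ε) = (2 ^ inputSize I ε) ^ 16 by rw [← pow_mul, mul_comm],
    pow_mul, pow_mul]
  refine ⟨by omega, ?_, ?_, ?_, fun i hi => ?_⟩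
  all_goals
    generalize 2 ^ inputSize I ε = X at *
  · calc 12 * (16 * inputSize I ε * (16 * inputSize I ε))
        = 3072 * (inputSize I ε * inputSize I ε) := by ring
      _ ≤ 3072 * (X * X) := Nat.mul_le_mul_left _ (Nat.mul_le_mul hS.le hS.le)
      _ < X ^ 3 * (X * X) := Nat.mul_lt_mul_of_pos_right
          (lt_of_lt_of_le (by norm_num) (Nat.pow_le_pow_left hX 3))
          (Nat.mul_pos (by omega) (by omega))
      _ = X ^ 5 := by ring
      _ ≤ X ^ 16 := Nat.pow_le_pow_right (by omega) (by norm_num)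
  · calc I.C * X ^ 8 < X * X ^ 8 := Nat.mul_lt_mul_of_pos_right hC (Nat.pow_pos (by omega))
      _ = X ^ 9 := by ring
      _ ≤ X ^ 16 := Nat.pow_le_pow_right (by omega) (by norm_num)
  · have h2 : X ≤ X ^ 4 := Nat.le_self_pow (by norm_num) X
    have h3 : 16 * X ^ 4 ≤ X * X ^ 4 := Nat.mul_le_mul_right _ hX
    have h4 : X * X ^ 4 ≤ X ^ 8 := by
      rw [← pow_succ']; exact Nat.pow_le_pow_right (by omega) (by norm_num)
    omega
  · have h2 := Nat.mul_le_mul (hW i hi) hD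
    have h3 := hc i hi
    have h4 : X * X ≤ X * (X * X) := Nat.le_mul_of_pos_left _ (by omega)
    have h5 : 16 * (X * (X * X)) ≤ X ^ 4 := by
      rw [show X ^ 4 = X * (X * (X * X)) by ring]; exact Nat.mul_le_mul_right _ hX
    have h6 : 0 < X * (X * X) := by positivity
    omega

theorem correct {s : State} (h0 : s.reg 0 = 16 * inputSize I ε * (16 * inputSize I ε) * 3)
    (h1 : s.reg 1 = 16 * inputSize I ε + 16 * inputSize I ε * (16 * inputSize I ε))
    (hm : s.mem = blockMem late (16 * inputSize I ε) (inputMem I ε)) :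
    Feasible I (output I s) ∧ ∀ y : Schedule I, Feasible I y →
      effectiveLateness late I (output I s) ≤ effectiveLateness late I y := by
  obtain ⟨b1, b2, b3, b4, b5⟩ := input_bounds late I ε
  have hn := numTasks_input I ε
  have hCeq := numMachines_input I ε
  have hDeq := demandAt_input I ε
  have hkeq := boundAt_input I ε
  have hoff := offsetAt_add late I ε
  have hcast := weightAt_cast I ε
  have hk : ∀ i < I.n, 0 < boundAt (16 * inputSize I ε) (inputMem I ε) i := fun i hi => by
    rw [hkeq ⟨i, hi⟩]; exact I.bound_pos _
  set K := 16 * inputSize I ε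
  set m := inputMem I ε
  have hV : violation (K / 2) (numTasks K m) (numMachines K m) (boundAt K m) (demandAt K m)
      (weightAt K m) (offsetAt late K m) (valueOf late K m) = 0 := by
    refine violation_optimum ?_
    rw [hn, hCeq]
    exact violation_of_large I.C_pos hk ((Nat.le_add_left _ _).trans_lt b4) b5
  have hVlt : valueOf late K m < 2 ^ (K / 2 / 2) := by
    unfold valueOf optimum; exact srch_lt _ _
  have hH : Hall (numTasks K m) (numMachines K m) (boundAt K m) (deadlineAt late K m)
    (demandAt K m) 0 := hall_of_violation hV
  have hdlt : ∀ i < I.n, deadlineAt late K m i < 2 ^ (K / 2) := fun i _ => deadline_lt i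
  have hout : ∀ (i : Fin I.n) t, output I s i t = machines (K / 2) I.n I.C (boundAt K m)
      (deadlineAt late K m) (demandAt K m) i t := by
    intro i t
    have := sum_blocks (late := late) b1 b2 b3 hH (show (i : ℕ) < numTasks K m by
      rw [hn]; exact i.2) t
    rw [hn, hCeq] at this
    rw [← this, output, h0, h1, hm]
  rw [hn, hCeq] at hH
  have hdone : ∀ i : Fin I.n, I.demand i ≤ done (output I s) i (deadlineAt late K m i) := by
    intro i
    have := le_sum_machines hH hdlt i i.2
    rw [hDeq] at this
    exact this.trans (sum_le_sum fun t _ => (hout i t).ge)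
  refine ⟨⟨fun i t _ => ?_, fun t _ => ?_, fun i => ⟨_, hdone i⟩⟩, fun y hy => ?_⟩
  · rw [hout, ← hkeq]
    exact machines_le hdlt i t
  · simp only [hout]
    rw [← sum_range fun i => machines (K / 2) I.n I.C (boundAt K m) (deadlineAt late K m)
      (demandAt K m) i t]
    exact sum_machines_le hH hdlt t
  have hval : ∀ i : Fin I.n, weightAt K m i * completionTime (output I s) i +
      offsetAt late K m i ≤ valueOf late K m := by
    intro i
    have h2 : completionTime (output I s) i ≤ deadlineAt late K m i := Nat.sInf_le (hdone i)
    rcases deadline_spec (G := K / 2) (W := weightAt K m) (c := offsetAt late K m)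
      (lam := valueOf late K m) i with h | h
    -- A deadline `0` may be the default of a search without success; a positive workload done by
    -- time `0` excludes it.
    · have h3 := hdone i
      have h4 := I.demand_pos i
      rw [deadlineAt, h] at h3
      simp [done] at h3
      omega
    · exact (Nat.add_le_add_right (Nat.mul_le_mul_left _ h2) _).trans h
  -- If `y` attained less than `valueOf`, it would attain `valueOf - 1`, where the search found a
  -- violation. Monotonicity of `violation` is not needed.
  have hle : ∀ lam, (∀ i : Fin I.n, weightAt K m i * completionTime y i + offsetAt late K m i ≤
      lam) → valueOf late K m ≤ lam := by
    intro lam hlam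
    by_contra! hlt
    have h2 : violation (K / 2) (numTasks K m) (numMachines K m) (boundAt K m) (demandAt K m)
        (weightAt K m) (offsetAt late K m) (valueOf late K m - 1) = 0 := by
      rw [hn, hCeq]
      refine violation_of_schedule (H := K / 2 / 2) I.C_pos hk (by omega) b4
        (fun i t => if h : i < I.n then y ⟨i, h⟩ t else 0)
        (fun i => if h : i < I.n then completionTime y ⟨i, h⟩ else 0) ?_ ?_ ?_ ?_
      · intro i hi t ht
        rw [dif_pos hi, hkeq ⟨i, hi⟩]
        exact hy.parallelism _ t ht
      · intro t ht
        rw [sum_range]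
        simpa using hy.capacity t ht
      · intro i hi
        simp only [dif_pos hi]
        rw [hDeq ⟨i, hi⟩]
        exact Nat.sInf_mem (hy.complete ⟨i, hi⟩)
      · intro i hi
        rw [dif_pos hi]
        have := hlam ⟨i, hi⟩
        dsimp only at this
        omega
    have := optimum_le h2
    have : valueOf late K m = 0 := this
    omega
  unfold effectiveLateness
  rcases isEmpty_or_nonempty (Fin I.n) with hemp | hne
  · simp
  -- The task of largest scaled cost under `y` bounds the scaled cost of every task in the output;
  -- removing the common shift and the common denominator gives back lateness.
  obtain ⟨i₀, -, hi₀⟩ := exists_max_image univ (fun i : Fin I.n =>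
    weightAt K m i * completionTime y i + offsetAt late K m i) univ_nonempty
  refine ciSup_le fun i => le_trans ?_ (le_ciSup (Set.finite_range _).bddAbove i₀)
  have h2 := (hval i).trans (hle _ fun i => hi₀ i (mem_univ i))
  have h3 := hoff i
  have h4 := hoff i₀
  have h5 : (weightAt K m i * completionTime (output I s) i + offsetAt late K m i : ℝ) ≤
    weightAt K m i₀ * completionTime y i₀ + offsetAt late K m i₀ := by exact_mod_cast h2
  have h6 : (offsetAt late K m i + weightAt K m i * effectiveDue late I i : ℝ) =
    offsetAt late K m i₀ + weightAt K m i₀ * effectiveDue late I i₀ := by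
    exact_mod_cast h3.trans h4.symm
  rw [hcast, hcast] at h5 h6
  refine le_of_mul_le_mul_right ?_ (commonDen_pos I)
  linarith

end Correctness

/-- The output is optimal, and the error term `ε * |L|` is nonnegative even when the lateness `L` is
negative. -/
theorem exists_approx (late : Bool) : ∃ P, IsPolyTimeApprox (effectiveLateness late) P := by
  obtain ⟨P, q, hP⟩ := exists_prog late
  refine ⟨P, q, fun I ε _ => ?_⟩
  obtain ⟨t, s, h1, h2, h3, h4, h5⟩ := hP (inputMem I ε)
  have e : ∑ a ∈ range (4 + 5 * inputMem I ε 0), (Nat.size (inputMem I ε a) + 1) =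
    inputSize I ε := (inputSize_eq I ε).symm
  rw [e] at h2 h3 h4 h5
  obtain ⟨h6, h7⟩ := correct late I ε h3 h4 h5
  refine ⟨t, s, h1, h2, h6, fun y hy => (h7 y hy).trans ?_⟩
  have : 0 ≤ (ε : ℝ) * |effectiveLateness late I y| := by positivity
  linarith

end Malleable

theorem mainTheorem8 :
    (∃ P : Malleable.Prog, Malleable.IsPolyTimeApprox Malleable.maxWeightedCompletion P) ∧
      ∃ P : Malleable.Prog, Malleable.IsPolyTimeApprox Malleable.maxWeightedLateness P := by
  have h1 : Malleable.maxWeightedCompletion = Malleable.effectiveLateness false := by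
    funext I y
    simp [Malleable.maxWeightedCompletion, Malleable.effectiveLateness, Malleable.effectiveDue]
  have h2 : Malleable.maxWeightedLateness = Malleable.effectiveLateness true := by
    funext I y
    simp [Malleable.maxWeightedLateness, Malleable.effectiveLateness, Malleable.effectiveDue]
  rw [h1, h2]
  exact ⟨Malleable.exists_approx false, Malleable.exists_approx true⟩
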